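/- Let $X$ be a complex Banach space and $L(X)$ the algebra of bounded linear operators on $X$. For $S\in L(X)$ write $\mathcal N(S)$ and $\mathcal R(S)$ for its kernel and range, $\alpha(S)=\dim\mathcal N(S)$ and $\beta(S)=\operatorname{codim}\mathcal R(S)$, where dimensions and codimensions take values in $\mathbb N\cup\{\infty\}$, and $$\mathcal K(S)=\{x\in X:\ \exists\,\varepsilon>0,\ \exists\,(u_n)_{n\ge0}\subset X,\ u_0=x,\ Su_{n+1}=u_n,\ \|u_n\|\le\varepsilon^n\|x\|\ \ \forall n\ge 0\},$$ $$\mathcal H_0(S)=\{x\in X:\ \lim_{n\to\infty}\|S^nx\|^{1/n}=0\}.$$ A bounded operator $S$ on a Banach space is called semi-regular if $\mathcal R(S)$ is closed and $\mathcal N(S)\subset\mathcal R(S^n)$ for every $n\in\mathbb N$; quasi-nilpotent if $S-\mu I$ is invertible for every complex $\mu\ne0$; and zeroloid if every accumulation point of its spectrum $\sigma(S)$ is equal to $0$. For $T\in L(X)$ write $(M,N)\in\mathrm{Red}(T)$ if $M,N$ are closed $T$-invariant subspaces of $X$ with $X=M\oplus N$, and let $T_M\in L(M)$, $T_N\in L(N)$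 be the restrictions of $T$. The operator $T$ is pseudo-Fredholm if there is $(M,N)\in\mathrm{Red}(T)$ such that $T_M$ is semi-regular and $T_N$ is quasi-nilpotent. Write $(M,N)\in g_zKD(T)$ if $(M,N)\in\mathrm{Red}(T)$, $T_M$ is semi-regular and $T_N$ is zeroloid; $T$ is $g_z$-Kato if such a pair exists. Theorem. Let $T\in L(X)$ be a $g_z$-Kato operator. For every $(M,N)\in g_zKD(T)$ there exists $\epsilon>0$ such that for all $\lambda\in\mathbb C$ with $0<|\lambda|<\epsilon$: (i) $T-\lambda I$ is pseudo-Fredholm; (ii) $\alpha(T_M)=\dim\big(\mathcal N(T-\lambda I)\cap\mathcal K(T-\lambda I)\big)\le\alpha(T-\lambda I)$; (iii) $\beta(T_M)=\operatorname{codim}\big(\mathcal R(T-\lambda I)+\mathcal H_0(T-\lambda I)\big)\le\beta(T-\lambda I)$. -/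

import Mathlib

open Filter Topology

namespace GzKato

section

variable {X : Type*} [NormedAddCommGroup X] [NormedSpace ℂ X]

/-- The dimension of a complex vector space, as an element of `ℕ ∪ {∞}`. -/
noncomputable def dim (V : Type*) [AddCommGroup V] [Module ℂ V] : ℕ∞ :=
  Cardinal.toENat (Module.rank ℂ V)

/-- The codimension of a subspace, as an element of `ℕ ∪ {∞}`. -/
noncomputable def codim (W : Submodule ℂ X) : ℕ∞ :=
  dim (X ⧸ W)

/-- The kernel `N(T)`. -/
def nullSpace (T : X →L[ℂ] X) : Submodule ℂ X :=
  LinearMap.ker (T : X →ₗ[ℂ] X)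

/-- The range `R(T)`. -/
def rangeSpace (T : X →L[ℂ] X) : Submodule ℂ X :=
  LinearMap.range (T : X →ₗ[ℂ] X)

/-- The nullity `α(T) = dim N(T)`. -/
noncomputable def nullity (T : X →L[ℂ] X) : ℕ∞ :=
  dim (nullSpace T)

/-- The deficiency `β(T) = codim R(T)`. -/
noncomputable def deficiency (T : X →L[ℂ] X) : ℕ∞ :=
  codim (rangeSpace T)

/-- The restriction `T_M : M → M` of `T` to a `T`-invariant subspace `M`. -/
def restr (T : X →L[ℂ] X) (M : Submodule ℂ X) (hM : ∀ x ∈ M, T x ∈ M) : M →L[ℂ] M :=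
  T.restrict hM

/-- `T` is semi-regular: its range is closed and `N(T) ⊆ R(Tⁿ)` for every `n`. -/
def IsSemiRegular (T : X →L[ℂ] X) : Prop :=
  IsClosed (rangeSpace T : Set X) ∧ ∀ n : ℕ, nullSpace T ≤ rangeSpace (T ^ n)

/-- `T` is quasi-nilpotent: `T - μI` is invertible in `L(X)` for every `μ ≠ 0`. -/
def IsQuasiNilpotent (T : X →L[ℂ] X) : Prop :=
  ∀ μ : ℂ, μ ≠ 0 → IsUnit (T - μ • (1 : X →L[ℂ] X))

/-- `T` is zeroloid: the spectrum of `T` has no accumulation point other than `0`. -/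
def IsZeroloid (T : X →L[ℂ] X) : Prop :=
  {μ : ℂ | AccPt μ (𝓟 (spectrum ℂ T))} ⊆ {0}

/-- `(M, N) ∈ Red(T)`: `M` and `N` are closed `T`-invariant subspaces with `X = M ⊕ N`. -/
structure IsRed (T : X →L[ℂ] X) (M N : Submodule ℂ X) : Prop where
  isClosed_left : IsClosed (M : Set X)
  isClosed_right : IsClosed (N : Set X)
  invariant_left : ∀ x ∈ M, T x ∈ M
  invariant_right : ∀ x ∈ N, T x ∈ N
  isCompl : IsCompl M N

/-- `(M, N)` is a generalized Kato zeroloid decomposition of `T`: it reduces `T`,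
`T_M` is semi-regular and `T_N` is zeroloid. -/
structure IsGzKD (T : X →L[ℂ] X) (M N : Submodule ℂ X) : Prop extends IsRed T M N where
  semiRegular : IsSemiRegular (restr T M invariant_left)
  zeroloid : IsZeroloid (restr T N invariant_right)

/-- `(M, N)` is a pseudo-Fredholm decomposition of `T`: it reduces `T`,
`T_M` is semi-regular and `T_N` is quasi-nilpotent. -/
structure IsGKD (T : X →L[ℂ] X) (M N : Submodule ℂ X) : Prop extends IsRed T M N where
  semiRegular : IsSemiRegular (restr T M invariant_left)
  quasiNilpotent : IsQuasiNilpotent (restr T N invariant_right)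

/-- `T` is pseudo-Fredholm: it has a pseudo-Fredholm decomposition. -/
def IsPseudoFredholm (T : X →L[ℂ] X) : Prop :=
  ∃ M N : Submodule ℂ X, IsGKD T M N

/-- The analytic core `K(T)`. -/
def analyticCore (T : X →L[ℂ] X) : Submodule ℂ X where
  carrier := {x | ∃ ε : ℝ, 0 < ε ∧ ∃ u : ℕ → X,
    x = u 0 ∧ (∀ n, T (u (n + 1)) = u n) ∧ ∀ n, ‖u n‖ ≤ ε ^ n * ‖x‖}
  zero_mem' := ⟨1, one_pos, fun _ => 0, by simp⟩
  add_mem' := by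
    rintro x y ⟨a, ha, u, hxu, hu, hua⟩ ⟨b, hb, v, hyv, hv, hvb⟩
    rcases eq_or_ne (x + y) 0 with h0 | h0
    · exact ⟨1, one_pos, fun _ => 0, by simp [h0]⟩
    have hpos : 0 < ‖x + y‖ := norm_pos_iff.mpr h0
    set C : ℝ := max 1 ((‖x‖ + ‖y‖) / ‖x + y‖) with hC
    have hC1 : 1 ≤ C := le_max_left _ _
    have hC2 : ‖x‖ + ‖y‖ ≤ C * ‖x + y‖ := by
      rw [← div_le_iff₀ hpos]
      exact le_max_right _ _
    have hm : 0 < max a b := lt_max_of_lt_left ha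
    refine ⟨max a b * C, by positivity, fun n => u n + v n, by rw [hxu, hyv],
      fun n => by rw [map_add, hu, hv], fun n => ?_⟩
    rcases Nat.eq_zero_or_pos n with rfl | hn
    · simp [← hxu, ← hyv]
    calc ‖u n + v n‖ ≤ ‖u n‖ + ‖v n‖ := norm_add_le _ _
      _ ≤ a ^ n * ‖x‖ + b ^ n * ‖y‖ := add_le_add (hua n) (hvb n)
      _ ≤ max a b ^ n * ‖x‖ + max a b ^ n * ‖y‖ := by
        gcongr
        · exact le_max_left _ _
        · exact le_max_right _ _
      _ = max a b ^ n * (‖x‖ + ‖y‖) := by ring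
      _ ≤ max a b ^ n * (C ^ n * ‖x + y‖) := by
        gcongr
        exact hC2.trans (by gcongr; exact le_self_pow₀ hC1 hn.ne')
      _ = (max a b * C) ^ n * ‖x + y‖ := by ring
  smul_mem' := by
    rintro c x ⟨a, ha, u, hxu, hu, hua⟩
    refine ⟨a, ha, fun n => c • u n, by rw [hxu], fun n => by rw [map_smul, hu], fun n => ?_⟩
    rw [norm_smul, norm_smul, mul_left_comm]
    exact mul_le_mul_of_nonneg_left (hua n) (norm_nonneg c)

/-- The quasi-nilpotent part `H₀(T)`. -/
def quasiNilpotentPart (T : X →L[ℂ] X) : Submodule ℂ X where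
  carrier := {x | Tendsto (fun n : ℕ => ‖(T ^ n) x‖ ^ (1 / (n : ℝ))) atTop (𝓝 0)}
  zero_mem' := by
    refine Tendsto.congr' (f₁ := fun _ => (0 : ℝ)) ?_ tendsto_const_nhds
    filter_upwards [eventually_ne_atTop 0] with n hn
    rw [map_zero, norm_zero, Real.zero_rpow]
    positivity
  add_mem' := by
    intro x y hx hy
    have hxy := Tendsto.add hx hy
    rw [add_zero] at hxy
    refine squeeze_zero' (Eventually.of_forall fun n => by positivity) ?_ hxy
    filter_upwards [eventually_ge_atTop 1] with n hn
    have h1 : (1 : ℝ) ≤ n := by exact_mod_cast hn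
    have hp0 : (0 : ℝ) ≤ 1 / (n : ℝ) := by positivity
    have hp1 : 1 / (n : ℝ) ≤ 1 := by
      rw [div_le_one (by linarith)]
      exact h1
    calc ‖(T ^ n) (x + y)‖ ^ (1 / (n : ℝ))
        ≤ (‖(T ^ n) x‖ + ‖(T ^ n) y‖) ^ (1 / (n : ℝ)) := by
          rw [map_add]
          exact Real.rpow_le_rpow (norm_nonneg _) (norm_add_le _ _) hp0
      _ ≤ _ := Real.rpow_add_le_add_rpow (norm_nonneg _) (norm_nonneg _) hp0 hp1
  smul_mem' := by
    intro c x hx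
    have hcx := Tendsto.const_mul (max 1 ‖c‖) hx
    rw [mul_zero] at hcx
    refine squeeze_zero' (Eventually.of_forall fun n => by positivity) ?_ hcx
    filter_upwards [eventually_ge_atTop 1] with n hn
    have h1 : (1 : ℝ) ≤ n := by exact_mod_cast hn
    have hp0 : (0 : ℝ) ≤ 1 / (n : ℝ) := by positivity
    have hp1 : 1 / (n : ℝ) ≤ 1 := by
      rw [div_le_one (by linarith)]
      exact h1
    rw [map_smul, norm_smul, Real.mul_rpow (norm_nonneg _) (norm_nonneg _)]
    gcongr
    calc ‖c‖ ^ (1 / (n : ℝ)) ≤ max 1 ‖c‖ ^ (1 / (n : ℝ)) :=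
          Real.rpow_le_rpow (norm_nonneg _) (le_max_right _ _) hp0
      _ ≤ max 1 ‖c‖ ^ (1 : ℝ) := Real.rpow_le_rpow_of_exponent_le (le_max_left _ _) hp1
      _ = max 1 ‖c‖ := Real.rpow_one _

end

end GzKato

/-! The two summands contribute independently, and only `M` forces `λ` to be small.

On `M`, let `K` be the hyper-range of `T_M`. Semi-regularity makes `T_M` surjective on `K` and
bounded below on `M/K`, and both properties survive small scalar perturbations. The kernel of `T_M`
lies in `K` and its range contains `K`, so the nullity is that of the surjective piece and the
deficiency that of the bounded-below piece. Each of these is lower semicontinuous in `λ`, and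
locally constant where finite, hence constant on a disc (`eq_of_isPreconnected`). The result is
`IsSemiRegular.exists_sub_smul`, which also places the kernel of `T_M - λ` in its analytic core and
its quasi-nilpotent part in its range.

On `N`, a nonzero `λ` is not an accumulation point of the spectrum of `T_N`, so the Riesz projection
at `λ` (`exists_riesz_projection`) splits `N` into a part where `T_N - λ` is quasi-nilpotent and a
part where it is invertible. Adding the invertible part to `M` gives a pseudo-Fredholm decomposition
of `T - λ`. The kernel of `T - λ` has no component in the invertible part, and the analytic core has
none in the quasi-nilpotent part, so their intersection is the kernel of `T_M - λ`. Dually, range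
plus quasi-nilpotent part contains all of `N`, and the quotient of `X` by it is `M` modulo the range
of `T_M - λ`. `IsSpectralSplitting` carries this bookkeeping. -/

/-! ### Riesz projections from Laurent coefficients of the resolvent. -/

section RieszProjection

open Metric

variable {A : Type*} [NormedRing A] [NormedAlgebra ℂ A]

/-- Multiplication by a fixed element on the left commutes with circle integrals. -/
theorem circleIntegral_const_mul_left [CompleteSpace A] (s : A) {f : ℂ → A} {c : ℂ} {r : ℝ}
    (hf : CircleIntegrable f c r) : (∮ z in C(c, r), s * f z) = s * ∮ z in C(c, r), f z := by
  have h := (ContinuousLinearMap.mul ℂ A s).intervalIntegral_comp_comm hf.out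
  simpa [circleIntegral] using h

/-- Multiplication by a fixed element on the right commutes with circle integrals. -/
theorem circleIntegral_mul_const_right [CompleteSpace A] (s : A) {f : ℂ → A} {c : ℂ} {r : ℝ}
    (hf : CircleIntegrable f c r) : (∮ z in C(c, r), f z * s) = (∮ z in C(c, r), f z) * s := by
  have h := ((ContinuousLinearMap.mul ℂ A).flip s).intervalIntegral_comp_comm hf.out
  simpa [circleIntegral] using h

/-- The (unnormalized) Laurent coefficients at `0` of the resolvent of `s`. -/
noncomputable def resolventMoment (s : A) (r : ℝ) (k : ℤ) : A :=
  ∮ z in C(0, r), z ^ k • resolvent s z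

theorem mul_resolvent_eq {s : A} {z : ℂ} (hz : z ∈ resolventSet ℂ s) :
    s * resolvent s z = z • resolvent s z - 1 := by
  have h : (algebraMap ℂ A z - s) * resolvent s z = 1 := Ring.mul_inverse_cancel _ hz
  rw [sub_mul, ← Algebra.smul_def] at h
  rw [← h]; abel

theorem resolvent_mul_eq {s : A} {z : ℂ} (hz : z ∈ resolventSet ℂ s) :
    resolvent s z * s = z • resolvent s z - 1 := by
  have h : resolvent s z * (algebraMap ℂ A z - s) = 1 := Ring.inverse_mul_cancel _ hz
  rw [mul_sub, ← Algebra.commutes, ← Algebra.smul_def] at h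
  rw [← h]; abel

variable [CompleteSpace A] {s : A} {ρ : ℝ}

theorem differentiableOn_zpow_smul_resolvent
    (hρ : ∀ z : ℂ, z ≠ 0 → ‖z‖ < ρ → z ∈ resolventSet ℂ s) (k : ℤ) :
    DifferentiableOn ℂ (fun z : ℂ => z ^ k • resolvent s z) (ball 0 ρ \ {0}) := by
  intro z hz
  have hz0 : z ≠ 0 := hz.2
  have hz1 : ‖z‖ < ρ := by simpa using hz.1
  exact (((differentiableAt_zpow).2 (Or.inl hz0)).smul
    (spectrum.hasDerivAt_resolvent_const_left (hρ z hz0 hz1)).differentiableAt).differentiableWithinAt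

theorem circleIntegrable_zpow_smul_resolvent
    (hρ : ∀ z : ℂ, z ≠ 0 → ‖z‖ < ρ → z ∈ resolventSet ℂ s) {r : ℝ} (hr : 0 < r) (hrρ : r < ρ)
    (k : ℤ) : CircleIntegrable (fun z : ℂ => z ^ k • resolvent s z) 0 r := by
  refine ContinuousOn.circleIntegrable hr.le
    ((differentiableOn_zpow_smul_resolvent hρ k).continuousOn.mono fun z hz => ?_)
  have hz : ‖z‖ = r := by simpa using hz
  refine ⟨by simpa [hz] using hrρ, ?_⟩
  rintro rfl
  simp at hz
  exact hr.ne hz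

/-- Cauchy's theorem on the annulus. Freedom to shrink the contour is what makes the nonnegative
moments decay faster than any geometric sequence. -/
theorem resolventMoment_eq_of_le
    (hρ : ∀ z : ℂ, z ≠ 0 → ‖z‖ < ρ → z ∈ resolventSet ℂ s) {r r' : ℝ} (hr : 0 < r) (hrr' : r ≤ r')
    (hrρ : r' < ρ) (k : ℤ) : resolventMoment s r' k = resolventMoment s r k := by
  have hd := differentiableOn_zpow_smul_resolvent hρ k
  refine Complex.circleIntegral_eq_of_differentiable_on_annulus_off_countable hr hrr'
    Set.countable_empty (hd.continuousOn.mono fun z hz => ?_) fun z hz => ?_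
  · have h1 : ‖z‖ ≤ r' := by simpa using hz.1
    have h2 : r ≤ ‖z‖ := by simpa using hz.2
    exact ⟨by simpa using h1.trans_lt hrρ, by rintro rfl; simp at h2; linarith⟩
  · have h1 : ‖z‖ < r' := by simpa using hz.1.1
    have h2 : r < ‖z‖ := by simpa using hz.1.2
    refine hd.differentiableAt ((isOpen_ball.sdiff isClosed_singleton).mem_nhds ?_)
    exact ⟨by simpa using h1.trans hrρ, by rintro rfl; simp at h2; linarith⟩

/-- The integrand is both `z ^ k • (s * resolvent s z)` and `z ^ k • (resolvent s z * s)`, so this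
yields the left and right recursions at once. The exception `k = -1` is the residue of `z⁻¹`. -/
theorem circleIntegral_zpow_smul_sub_one
    (hρ : ∀ z : ℂ, z ≠ 0 → ‖z‖ < ρ → z ∈ resolventSet ℂ s) {r : ℝ} (hr : 0 < r) (hrρ : r < ρ)
    (k : ℤ) : (∮ z in C(0, r), z ^ k • (z • resolvent s z - 1)) =
      resolventMoment s r (k + 1) - if k = -1 then (2 * Real.pi * Complex.I : ℂ) • 1 else 0 := by
  have h1 : (∮ z in C(0, r), z ^ k • (z • resolvent s z - 1)) =
      ∮ z in C(0, r), (z ^ (k + 1) • resolvent s z - z ^ k • (1 : A)) := by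
    refine circleIntegral.integral_congr hr.le fun z hz => ?_
    have hz : ‖z‖ = r := by simpa using hz
    have hz0 : z ≠ 0 := by rintro rfl; simp at hz; exact hr.ne hz
    simp only [smul_sub, smul_smul, zpow_add_one₀ hz0]
  have h2 : CircleIntegrable (fun z : ℂ => z ^ k • (1 : A)) 0 r := by
    refine ContinuousOn.circleIntegrable hr.le fun z hz => ?_
    have hz : ‖z‖ = r := by simpa using hz
    have hz0 : z ≠ 0 := by rintro rfl; simp at hz; exact hr.ne hz
    exact ((continuousAt_zpow₀ z k (Or.inl hz0)).smul continuousAt_const).continuousWithinAt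
  rw [h1, circleIntegral.integral_sub (circleIntegrable_zpow_smul_resolvent hρ hr hrρ _) h2,
    circleIntegral.integral_smul_const]
  congr 1
  split_ifs with hk
  · subst hk
    have := circleIntegral.integral_sub_center_inv 0 hr.ne'
    simp only [sub_zero] at this
    simp [this]
  · have := circleIntegral.integral_sub_zpow_of_ne hk 0 0 r
    simp only [sub_zero] at this
    simp [this]

theorem mul_resolventMoment
    (hρ : ∀ z : ℂ, z ≠ 0 → ‖z‖ < ρ → z ∈ resolventSet ℂ s) {r : ℝ} (hr : 0 < r) (hrρ : r < ρ)
    (k : ℤ) : s * resolventMoment s r k =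
      resolventMoment s r (k + 1) - if k = -1 then (2 * Real.pi * Complex.I : ℂ) • 1 else 0 := by
  rw [← circleIntegral_zpow_smul_sub_one hρ hr hrρ, resolventMoment,
    ← circleIntegral_const_mul_left _ (circleIntegrable_zpow_smul_resolvent hρ hr hrρ k)]
  refine circleIntegral.integral_congr hr.le fun z hz => ?_
  have hz : ‖z‖ = r := by simpa using hz
  have hz0 : z ≠ 0 := by rintro rfl; simp at hz; exact hr.ne hz
  simp only [mul_smul_comm, mul_resolvent_eq (hρ z hz0 (by rwa [hz]))]

theorem resolventMoment_mul
    (hρ : ∀ z : ℂ, z ≠ 0 → ‖z‖ < ρ → z ∈ resolventSet ℂ s) {r : ℝ} (hr : 0 < r) (hrρ : r < ρ)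
    (k : ℤ) : resolventMoment s r k * s =
      resolventMoment s r (k + 1) - if k = -1 then (2 * Real.pi * Complex.I : ℂ) • 1 else 0 := by
  rw [← circleIntegral_zpow_smul_sub_one hρ hr hrρ, resolventMoment,
    ← circleIntegral_mul_const_right _ (circleIntegrable_zpow_smul_resolvent hρ hr hrρ k)]
  refine circleIntegral.integral_congr hr.le fun z hz => ?_
  have hz : ‖z‖ = r := by simpa using hz
  have hz0 : z ≠ 0 := by rintro rfl; simp at hz; exact hr.ne hz
  simp only [smul_mul_assoc, resolvent_mul_eq (hρ z hz0 (by rwa [hz]))]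

/-- One constant, from the supremum of the resolvent on the circle, serves all integers `k`,
including negative ones. -/
theorem exists_norm_resolventMoment_le
    (hρ : ∀ z : ℂ, z ≠ 0 → ‖z‖ < ρ → z ∈ resolventSet ℂ s) {r : ℝ} (hr : 0 < r) (hrρ : r < ρ) :
    ∃ C : ℝ, 0 ≤ C ∧ ∀ k : ℤ, ‖resolventMoment s r k‖ ≤ C * r ^ k := by
  have hc : ContinuousOn (fun z : ℂ => z ^ (0 : ℤ) • resolvent s z) (sphere 0 r) :=
    (differentiableOn_zpow_smul_resolvent hρ 0).continuousOn.mono fun z hz => by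
      have hz : ‖z‖ = r := by simpa using hz
      refine ⟨by simpa [hz] using hrρ, ?_⟩
      rintro rfl
      simp at hz
      exact hr.ne hz
  obtain ⟨C, hC⟩ := (isCompact_sphere (0 : ℂ) r).exists_bound_of_continuousOn hc
  refine ⟨2 * Real.pi * r * max C 0, by positivity, fun k => ?_⟩
  refine (circleIntegral.norm_integral_le_of_norm_le_const (C := r ^ k * max C 0) hr.le
    fun z hz => ?_).trans_eq (by ring)
  have h := hC z hz
  have hz : ‖z‖ = r := by simpa using hz
  rw [norm_smul, norm_zpow, hz]
  gcongr
  exact (by simpa using h : _ ≤ C).trans (le_max_left _ _)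

/-- The Riesz projection of an element `s` for which `0` is not an accumulation point of the
spectrum: an idempotent `p` commuting with `s` such that `s` is invertible modulo `p` and
quasi-nilpotent on `p`. -/
theorem exists_riesz_projection_of_punctured_ball (h0ρ : 0 < ρ)
    (hρ : ∀ z : ℂ, z ≠ 0 → ‖z‖ < ρ → z ∈ resolventSet ℂ s) :
    ∃ p c : A, p * p = p ∧ s * p = p * s ∧ s * c = 1 - p ∧ c * s = 1 - p ∧
      ∀ r : ℝ, 0 < r → ∃ C : ℝ, ∀ n : ℕ, ‖s ^ n * p‖ ≤ C * r ^ n := by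
  set w : ℂ := 2 * Real.pi * Complex.I with hw
  have hw0 : w ≠ 0 := Complex.two_pi_I_ne_zero
  set R : ℝ := ρ / 2 with hR
  have hR0 : 0 < R := by positivity
  have hRρ : R < ρ := by linarith
  have hpow : ∀ n : ℕ, s ^ n * resolventMoment s R 0 = resolventMoment s R n := by
    intro n
    induction n with
    | zero => simp
    | succ n ih =>
      rw [pow_succ', mul_assoc, ih, mul_resolventMoment hρ hR0 hRρ, if_neg (by lia)]
      simp
  have hneg : ∀ n : ℕ, s ^ n * resolventMoment s R (-1 - n) = resolventMoment s R (-1) := by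
    intro n
    induction n with
    | zero => simp
    | succ n ih =>
      rw [pow_succ, mul_assoc, mul_resolventMoment hρ hR0 hRρ, if_neg (by push_cast; lia), sub_zero,
        show (-1 - ((n + 1 : ℕ) : ℤ) + 1) = -1 - n by push_cast; ring, ih]
  have hdecay : ∀ r : ℝ, 0 < r → ∃ C : ℝ, 0 ≤ C ∧
      ∀ n : ℕ, ‖resolventMoment s R n‖ ≤ C * r ^ n := by
    intro r hr
    have hm : 0 < min r R := lt_min hr hR0
    obtain ⟨C, hC0, hC⟩ := exists_norm_resolventMoment_le hρ hm ((min_le_right r R).trans_lt hRρ)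
    refine ⟨C, hC0, fun n => ?_⟩
    rw [resolventMoment_eq_of_le hρ hm (min_le_right r R) hRρ]
    refine (hC n).trans ?_
    rw [zpow_natCast]
    gcongr
    exact min_le_left _ _
  set p : A := w⁻¹ • resolventMoment s R 0 with hp
  set c : A := -(w⁻¹ • resolventMoment s R (-1)) with hc
  have hsc : s * c = 1 - p := by
    rw [hc, mul_neg, mul_smul_comm, mul_resolventMoment hρ hR0 hRρ, if_pos rfl, smul_sub, smul_smul,
      inv_mul_cancel₀ hw0, one_smul, hp]
    simp
  have hcs : c * s = 1 - p := by
    rw [hc, neg_mul, smul_mul_assoc, resolventMoment_mul hρ hR0 hRρ, if_pos rfl, smul_sub,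
      smul_smul, inv_mul_cancel₀ hw0, one_smul, hp]
    simp
  have hcomm : s * p = p * s := by
    rw [hp, mul_smul_comm, smul_mul_assoc, mul_resolventMoment hρ hR0 hRρ,
      resolventMoment_mul hρ hR0 hRρ]
  have hsp : ∀ n : ℕ, s ^ n * p = w⁻¹ • resolventMoment s R n := fun n => by
    rw [hp, mul_smul_comm, hpow]
  refine ⟨p, c, ?_, hcomm, hsc, hcs, fun r hr => ?_⟩
  -- Since `1 - p = c * s`, it suffices that `p * c = 0`. The recursion rewrites `p * c` as a
  -- product of the moments of index `n` and `-1 - n`, up to a scalar. The first is `O((R / 2) ^ n)`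
  -- and the second `O(R ^ (-n))`, so the fixed element `p * c` is `O(2 ^ (-n))`.
  · have hzero : p * (1 - p) = 0 := by
      obtain ⟨C, hC0, hC⟩ := hdecay (R / 2) (by positivity)
      obtain ⟨D, hD0, hD⟩ := exists_norm_resolventMoment_le hρ hR0 hRρ
      have hbound : ∀ n : ℕ, ‖p * c‖ ≤ ‖w⁻¹‖ * C * (‖w⁻¹‖ * D * R ^ (-1 : ℤ)) * (1 / 2) ^ n := by
        intro n
        have hpn : s ^ n * p = p * s ^ n := (show Commute s p from hcomm).pow_left n
        have h1 : p * c = (w⁻¹ • resolventMoment s R n) *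
            (-(w⁻¹ • resolventMoment s R (-1 - n))) := by
          rw [← hsp, hpn, mul_assoc, mul_neg (s ^ n), mul_smul_comm _ (s ^ n), hneg, hc]
        rw [h1]
        refine (norm_mul_le _ _).trans ?_
        rw [norm_neg, norm_smul, norm_smul]
        calc ‖w⁻¹‖ * ‖resolventMoment s R n‖ * (‖w⁻¹‖ * ‖resolventMoment s R (-1 - n)‖)
            ≤ ‖w⁻¹‖ * (C * (R / 2) ^ n) * (‖w⁻¹‖ * (D * R ^ (-1 - n : ℤ))) := by
              gcongr
              · exact hC n
              · exact hD _
          _ = _ := by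
              rw [zpow_sub₀ hR0.ne', zpow_natCast, div_pow, one_div, inv_pow]
              field_simp
      have ht : Tendsto (fun n : ℕ => ‖w⁻¹‖ * C * (‖w⁻¹‖ * D * R ^ (-1 : ℤ)) * (1 / 2 : ℝ) ^ n)
          atTop (𝓝 0) := by
        simpa using (tendsto_pow_atTop_nhds_zero_of_lt_one (by norm_num : (0 : ℝ) ≤ 1 / 2)
          (by norm_num)).const_mul (‖w⁻¹‖ * C * (‖w⁻¹‖ * D * R ^ (-1 : ℤ)))
      have hpc : p * c = 0 :=
        norm_le_zero_iff.1 (ge_of_tendsto' ht hbound)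
      rw [← hcs, ← mul_assoc, hpc, zero_mul]
    rw [mul_sub, mul_one, sub_eq_zero] at hzero
    exact hzero.symm
  · obtain ⟨C, -, hC⟩ := hdecay r hr
    refine ⟨‖w⁻¹‖ * C, fun n => ?_⟩
    rw [hsp, norm_smul, mul_assoc]
    gcongr
    exact hC n

/-- The Riesz projection at a point which is not an accumulation point of the spectrum. -/
theorem exists_riesz_projection {a : A} {μ : ℂ} (h : ¬ AccPt μ (𝓟 (spectrum ℂ a))) :
    ∃ p c : A, p * p = p ∧ (a - μ • 1) * p = p * (a - μ • 1) ∧ (a - μ • 1) * c = 1 - p ∧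
      c * (a - μ • 1) = 1 - p ∧
      ∀ r : ℝ, 0 < r → ∃ C : ℝ, ∀ n : ℕ, ‖(a - μ • 1) ^ n * p‖ ≤ C * r ^ n := by
  rw [accPt_iff_frequently_nhdsNE, not_frequently, eventually_nhdsWithin_iff,
    Metric.eventually_nhds_iff] at h
  obtain ⟨ρ, hρ0, hρ⟩ := h
  refine exists_riesz_projection_of_punctured_ball hρ0 fun z hz hzρ => ?_
  have h1 := hρ (y := z + μ) (by simpa using hzρ) (by simpa using hz)
  have h2 : z + μ ∈ resolventSet ℂ a := by
    simpa [spectrum] using h1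
  rw [spectrum.mem_resolventSet_iff] at h2 ⊢
  convert h2 using 1
  rw [map_add, Algebra.algebraMap_eq_smul_one μ]
  abel

end RieszProjection

namespace GzKato

/-! ### Dimensions in `ℕ∞` and a connectedness principle. -/

section Dimension

theorem dim_congr {V W : Type*} [AddCommGroup V] [Module ℂ V] [AddCommGroup W] [Module ℂ W]
    (e : V ≃ₗ[ℂ] W) : dim V = dim W := by
  have h := congrArg Cardinal.toENat e.lift_rank_eq
  simpa [dim] using h

theorem natCast_le_dim_iff {V : Type*} [AddCommGroup V] [Module ℂ V] {m : ℕ} :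
    (m : ℕ∞) ≤ dim V ↔ ∃ v : Fin m → V, LinearIndependent ℂ v := by
  rw [dim, Cardinal.natCast_le_toENat, Module.le_rank_iff]

theorem finiteDimensional_of_dim_ne_top {V : Type*} [AddCommGroup V] [Module ℂ V]
    (h : dim V ≠ ⊤) : FiniteDimensional ℂ V := by
  rw [dim, ← lt_top_iff_ne_top, Cardinal.toENat_lt_top, Module.rank_lt_aleph0_iff] at h
  exact h

theorem dim_le_of_le {V : Type*} [AddCommGroup V] [Module ℂ V] {p q : Submodule ℂ V}
    (h : p ≤ q) : dim p ≤ dim q :=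
  OrderHomClass.mono Cardinal.toENat (Submodule.rank_mono h)

theorem codim_le_of_le {X : Type*} [NormedAddCommGroup X] [NormedSpace ℂ X]
    {p q : Submodule ℂ X} (h : p ≤ q) : codim q ≤ codim p :=
  OrderHomClass.mono Cardinal.toENat
    (LinearMap.rank_le_of_surjective (Submodule.factor h) (Submodule.factor_surjective h))

/-- An `ℕ∞`-valued function on a preconnected set is constant if it is lower semicontinuous and
locally constant where it is finite. -/
theorem eq_of_isPreconnected {α : Type*} [TopologicalSpace α] {s : Set α} (hs : IsPreconnected s)
    {f : α → ℕ∞}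
    (hlow : ∀ x ∈ s, ∀ m : ℕ, (m : ℕ∞) ≤ f x → ∀ᶠ y in 𝓝 x, (m : ℕ∞) ≤ f y)
    (hfin : ∀ x ∈ s, f x ≠ ⊤ → ∀ᶠ y in 𝓝 x, f y = f x) {x y : α} (hx : x ∈ s) (hy : y ∈ s) :
    f x = f y := by
  classical
  have key : ∀ m : ℕ, ((m : ℕ∞) ≤ f x ↔ (m : ℕ∞) ≤ f y) := by
    intro m
    -- This truth value is locally constant: where it is true by lower semicontinuity, and where it
    -- is false because `f` is then finite.
    have hc : ContinuousOn (fun z => decide ((m : ℕ∞) ≤ f z)) s := by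
      intro z hz
      refine ContinuousAt.continuousWithinAt ?_
      refine (tendsto_pure.2 ?_).mono_right (pure_le_nhds _)
      by_cases hm : (m : ℕ∞) ≤ f z
      · filter_upwards [hlow z hz m hm] with w hw
        simp [hm, hw]
      · filter_upwards [hfin z hz (fun h => hm (by simp [h]))] with w hw
        rw [hw]
    simpa using hs.constant hc hx hy
  refine le_antisymm (ENat.forall_natCast_le_iff_le.1 fun m hm => (key m).1 hm)
    (ENat.forall_natCast_le_iff_le.1 fun m hm => (key m).2 hm)

end Dimension

/-! ### Stability of nullity and deficiency under scalar perturbations. -/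

section Perturbation

variable {E : Type*} [NormedAddCommGroup E] [NormedSpace ℂ E]

theorem sub_smul_sub_smul (D : E →L[ℂ] E) (l m : ℂ) :
    D - l • (1 : E →L[ℂ] E) - (m - l) • (1 : E →L[ℂ] E) = D - m • (1 : E →L[ℂ] E) := by
  rw [sub_smul]; abel

theorem eventually_nhds_of_eventually_zero {l : ℂ} {P : (E →L[ℂ] E) → Prop} {D : E →L[ℂ] E}
    (h : ∀ᶠ m : ℂ in 𝓝 0, P (D - l • (1 : E →L[ℂ] E) - m • (1 : E →L[ℂ] E))) :
    ∀ᶠ m : ℂ in 𝓝 l, P (D - m • (1 : E →L[ℂ] E)) := by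
  have ht : Tendsto (fun m : ℂ => m - l) (𝓝 l) (𝓝 0) := by
    simpa using (by fun_prop : Continuous fun m : ℂ => m - l).tendsto l
  filter_upwards [ht.eventually h] with m hm
  rwa [sub_smul_sub_smul] at hm

/-- Backward orbits of a surjective operator with geometric growth. -/
theorem exists_backward_orbit [CompleteSpace E] {D : E →L[ℂ] E} (hD : Function.Surjective D) :
    ∃ C : ℝ, 0 < C ∧ ∀ x : E, ∃ u : ℕ → E, u 0 = x ∧ (∀ n, D (u (n + 1)) = u n) ∧
      ∀ n, ‖u n‖ ≤ C ^ n * ‖x‖ := by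
  obtain ⟨C, hC, hg⟩ := D.exists_preimage_norm_le hD
  choose g hg1 hg2 using hg
  refine ⟨C, hC, fun x => ⟨fun n => g^[n] x, rfl, fun n => ?_, fun n => ?_⟩⟩
  · simp only [Function.iterate_succ_apply', hg1]
  · induction n with
    | zero => simp
    | succ n ih =>
      simp only [Function.iterate_succ_apply']
      calc _ ≤ C * ‖g^[n] x‖ := hg2 _
        _ ≤ C * (C ^ n * ‖x‖) := by gcongr
        _ = _ := by ring

/-- Solutions of `(D - l) x = D x₀` depending continuously on `l` near `0`. -/
theorem exists_perturbed_solution [CompleteSpace E] {D : E →L[ℂ] E}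
    (hD : Function.Surjective D) :
    ∃ C : ℝ, 0 < C ∧ ∀ (x₀ : E) (l : ℂ), C * ‖l‖ < 1 →
      ∃ x, (D - l • (1 : E →L[ℂ] E)) x = D x₀ ∧
        ‖x - x₀‖ ≤ C * ‖l‖ * ‖x₀‖ * (1 - C * ‖l‖)⁻¹ := by
  obtain ⟨C, hC, hu⟩ := exists_backward_orbit hD
  refine ⟨C, hC, fun x₀ l hl => ?_⟩
  obtain ⟨u, hu0, hu1, hu2⟩ := hu x₀
  have hq : 0 ≤ C * ‖l‖ := by positivity
  have hgeo := hasSum_geometric_of_lt_one hq hl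
  have hb : ∀ n, ‖l ^ n • u n‖ ≤ ‖x₀‖ * (C * ‖l‖) ^ n := fun n => by
    rw [norm_smul, norm_pow]
    calc ‖l‖ ^ n * ‖u n‖ ≤ ‖l‖ ^ n * (C ^ n * ‖x₀‖) := by gcongr; exact hu2 n
      _ = _ := by ring
  have hsum : Summable fun n => l ^ n • u n :=
    Summable.of_norm_bounded (hgeo.summable.mul_left ‖x₀‖) hb
  -- As `D` shifts the backward orbit `u` of `x₀`, it sends the tail of this series to `l • x`, so
  -- `(D - l) x = D x₀`.
  set x := ∑' n, l ^ n • u n with hx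
  have hx1 : x = x₀ + ∑' n, l ^ (n + 1) • u (n + 1) := by
    rw [hx, hsum.tsum_eq_zero_add]; simp [hu0]
  have hsum1 : Summable fun n => l ^ (n + 1) • u (n + 1) := (summable_nat_add_iff 1).2 hsum
  refine ⟨x, ?_, ?_⟩
  · have h1 : D (∑' n, l ^ (n + 1) • u (n + 1)) = l • x := by
      rw [D.map_tsum hsum1, hx, ← tsum_const_smul'' l]
      congr 1
      ext n
      rw [map_smul, hu1, smul_smul, pow_succ']
    have h2 : D x = D x₀ + l • x := by
      conv_lhs => rw [hx1]
      rw [map_add, h1]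
    simp [h2]
  · rw [hx1, add_sub_cancel_left]
    refine tsum_of_norm_bounded (hgeo.mul_left (C * ‖l‖ * ‖x₀‖)) fun n => ?_
    refine (hb (n + 1)).trans_eq (by ring)

theorem eventually_surjective_sub_smul [CompleteSpace E] {D : E →L[ℂ] E}
    (hD : Function.Surjective D) :
    ∃ ε : ℝ, 0 < ε ∧ ∀ l : ℂ, ‖l‖ < ε → Function.Surjective (D - l • (1 : E →L[ℂ] E)) := by
  obtain ⟨C, hC, h⟩ := exists_perturbed_solution hD
  refine ⟨C⁻¹, by positivity, fun l hl y => ?_⟩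
  obtain ⟨x₀, rfl⟩ := hD y
  obtain ⟨x, hx, -⟩ := h x₀ l (by rwa [← lt_inv_mul_iff₀ hC, mul_one])
  exact ⟨x, hx⟩

/-- Independent kernel vectors of `D` move to kernel vectors of `D - l` that converge to them as `l`
tends to `0`, and linear independence of a finite family is an open condition. -/
theorem eventually_le_nullity [CompleteSpace E] {D : E →L[ℂ] E} (hD : Function.Surjective D)
    {m : ℕ} (hm : (m : ℕ∞) ≤ nullity D) :
    ∀ᶠ l : ℂ in 𝓝 0, (m : ℕ∞) ≤ nullity (D - l • (1 : E →L[ℂ] E)) := by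
  obtain ⟨v, hv⟩ := natCast_le_dim_iff.1 hm
  obtain ⟨C, hC, h⟩ := exists_perturbed_solution hD
  have hv' : LinearIndependent ℂ fun i => (v i : E) :=
    hv.map' (nullSpace D).subtype (Submodule.ker_subtype _)
  have hsmall : ∀ᶠ l : ℂ in 𝓝 0, C * ‖l‖ < 1 := by
    have : Tendsto (fun l : ℂ => C * ‖l‖) (𝓝 0) (𝓝 0) := by
      simpa using (by fun_prop : Continuous fun l : ℂ => C * ‖l‖).tendsto 0
    exact this.eventually (gt_mem_nhds one_pos)
  choose! x hx1 hx2 using h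
  have ht : Tendsto (fun l : ℂ => fun i => x (v i : E) l) (𝓝 0) (𝓝 fun i => (v i : E)) := by
    refine tendsto_pi_nhds.2 fun i => ?_
    rw [tendsto_iff_norm_sub_tendsto_zero]
    have hlim : Tendsto (fun l : ℂ => C * ‖l‖ * ‖(v i : E)‖ * (1 - C * ‖l‖)⁻¹) (𝓝 0) (𝓝 0) := by
      have : ContinuousAt (fun l : ℂ => C * ‖l‖ * ‖(v i : E)‖ * (1 - C * ‖l‖)⁻¹) 0 := by
        refine ContinuousAt.mul (by fun_prop) (ContinuousAt.inv₀ (by fun_prop) (by simp))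
      simpa [ContinuousAt] using this
    refine squeeze_zero' (Eventually.of_forall fun l => norm_nonneg _) ?_ hlim
    filter_upwards [hsmall] with l hl using hx2 _ l hl
  filter_upwards [ht.eventually hv'.eventually, hsmall] with l hl hl1
  have hmem : ∀ i, x (v i : E) l ∈ nullSpace (D - l • (1 : E →L[ℂ] E)) := fun i => by
    have h1 : D (v i : E) = 0 := (v i).2
    exact (hx1 (v i : E) l hl1).trans h1
  exact natCast_le_dim_iff.2 ⟨fun i => ⟨x (v i : E) l, hmem i⟩,
    LinearIndependent.of_comp (nullSpace (D - l • (1 : E →L[ℂ] E))).subtype hl⟩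

/-- A surjective operator with finite-dimensional kernel has a bounded right inverse. -/
theorem exists_rightInverse_of_nullity_ne_top [CompleteSpace E] {D : E →L[ℂ] E}
    (hD : Function.Surjective D) (hfin : nullity D ≠ ⊤) : ∃ R : E →L[ℂ] E, D * R = 1 := by
  have : FiniteDimensional ℂ (nullSpace D) := finiteDimensional_of_dim_ne_top hfin
  obtain ⟨q, hq⟩ := Submodule.ClosedComplemented.of_finiteDimensional (𝕜 := ℂ) (nullSpace D)
  have hDq : ∀ k : nullSpace D, D (k : E) = 0 := fun k => k.2
  -- With `q` a projection onto the kernel, `x ↦ (D x, q x)` is an isomorphism; the right inverse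
  -- sends `y` to the preimage of `(y, 0)`.
  have hinj : (D.prod q).ker = ⊥ := by
    rw [LinearMap.ker_eq_bot']
    intro x hx
    have h1 : D x = 0 := congrArg Prod.fst hx
    have h2 : q x = 0 := congrArg Prod.snd hx
    have h3 := hq ⟨x, h1⟩
    rw [h2] at h3
    exact (congrArg Subtype.val h3).symm
  have hsurj : (D.prod q).range = ⊤ := by
    rw [LinearMap.range_eq_top]
    rintro ⟨y, k⟩
    obtain ⟨x, rfl⟩ := hD y
    refine ⟨x - q x + k, ?_⟩
    simp [hDq, hq]
  have : IsClosed (nullSpace D : Set E) := D.isClosed_ker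
  have : CompleteSpace (nullSpace D) := this.completeSpace_coe
  let e := ContinuousLinearEquiv.ofBijective (D.prod q) hinj hsurj
  refine ⟨(e.symm : E × nullSpace D →L[ℂ] E).comp (ContinuousLinearMap.inl ℂ E _), ?_⟩
  ext y
  exact congrArg Prod.fst (e.apply_symm_apply (y, 0))

theorem eventually_isUnit_one_sub_smul [CompleteSpace E] (R : E →L[ℂ] E) :
    ∀ᶠ l : ℂ in 𝓝 0, IsUnit (1 - l • R) := by
  have : Tendsto (fun l : ℂ => ‖l • R‖) (𝓝 0) (𝓝 0) := by
    simpa using (by fun_prop : Continuous fun l : ℂ => ‖l • R‖).tendsto 0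
  filter_upwards [this.eventually (gt_mem_nhds one_pos)] with l hl
  exact isUnit_one_sub_of_norm_lt_one hl

/-- A right inverse `R` gives `D - l = D (1 - l R)`, whose second factor is invertible for small
`l`. -/
theorem eventually_nullity_eq [CompleteSpace E] {D : E →L[ℂ] E} (hD : Function.Surjective D)
    (hfin : nullity D ≠ ⊤) :
    ∀ᶠ l : ℂ in 𝓝 0, nullity (D - l • (1 : E →L[ℂ] E)) = nullity D := by
  obtain ⟨R, hR⟩ := exists_rightInverse_of_nullity_ne_top hD hfin
  filter_upwards [eventually_isUnit_one_sub_smul R] with l hl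
  obtain ⟨U, hU⟩ := hl
  have hfac : D - l • (1 : E →L[ℂ] E) = D * U := by
    rw [hU, mul_sub, mul_one, mul_smul_comm, hR]
  let e : E ≃ₗ[ℂ] E := (ContinuousLinearEquiv.unitsEquiv ℂ E U).toLinearEquiv
  have he : ∀ x, e x = (U : E →L[ℂ] E) x := fun x => rfl
  have hker : nullSpace (D - l • (1 : E →L[ℂ] E)) = (nullSpace D).comap (e : E →ₗ[ℂ] E) := by
    ext x
    rw [hfac]
    rfl
  rw [nullity, hker]
  exact dim_congr (e.ofSubmodule' (nullSpace D))

/-- The nullity of a surjective operator is stable under small scalar perturbations. -/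
theorem exists_nullity_sub_smul_eq [CompleteSpace E] {D : E →L[ℂ] E}
    (hD : Function.Surjective D) :
    ∃ ε : ℝ, 0 < ε ∧ ∀ l : ℂ, ‖l‖ < ε → Function.Surjective (D - l • (1 : E →L[ℂ] E)) ∧
      nullity (D - l • (1 : E →L[ℂ] E)) = nullity D := by
  obtain ⟨ε, hε, hs⟩ := eventually_surjective_sub_smul hD
  refine ⟨ε, hε, fun l hl => ⟨hs l hl, ?_⟩⟩
  -- Infinite nullity admits no direct local comparison, hence the passage through connectedness of
  -- the disc.
  have hconn : IsPreconnected (Metric.ball (0 : ℂ) ε) := (convex_ball 0 ε).isPreconnected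
  have h := eq_of_isPreconnected hconn (f := fun l : ℂ => nullity (D - l • (1 : E →L[ℂ] E)))
    (fun z hz m hm => eventually_nhds_of_eventually_zero
      (P := fun S => (m : ℕ∞) ≤ nullity S) (eventually_le_nullity (hs z (by simpa using hz)) hm))
    (fun z hz hfin => eventually_nhds_of_eventually_zero
      (P := fun S => nullity S = nullity (D - z • (1 : E →L[ℂ] E)))
      (eventually_nullity_eq (hs z (by simpa using hz)) hfin))
    (x := l) (y := 0) (by simpa using hl) (by simpa using hε)
  simpa using h

/-- The operator `S` is bounded below. -/
def BoundedBelow {F : Type*} [NormedAddCommGroup F] [NormedSpace ℂ F] (S : E →L[ℂ] F) : Prop :=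
  ∃ c : ℝ, 0 < c ∧ ∀ x, c * ‖x‖ ≤ ‖S x‖

theorem BoundedBelow.injective {F : Type*} [NormedAddCommGroup F] [NormedSpace ℂ F]
    {S : E →L[ℂ] F} (h : BoundedBelow S) : Function.Injective S := by
  obtain ⟨c, hc, hS⟩ := h
  refine (injective_iff_map_eq_zero S).2 fun x hx => ?_
  have := hS x
  rw [hx, norm_zero] at this
  exact norm_le_zero_iff.1 (nonpos_of_mul_nonpos_right this hc)

theorem boundedBelow_of_injective_of_isClosed_range {F : Type*} [NormedAddCommGroup F]
    [NormedSpace ℂ F] [CompleteSpace E] [CompleteSpace F]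
    {S : E →L[ℂ] F} (h : Function.Injective S) (hc : IsClosed (Set.range S)) : BoundedBelow S := by
  obtain ⟨K, hK⟩ := S.antilipschitz_of_injective_of_isClosed_range h hc
  refine ⟨((K : ℝ) + 1)⁻¹, by positivity, fun x => ?_⟩
  have h1 := hK.le_mul_dist x 0
  rw [map_zero, dist_zero_right, dist_zero_right] at h1
  rw [inv_mul_le_iff₀ (by positivity)]
  nlinarith [norm_nonneg (S x)]

theorem BoundedBelow.isClosed_range [CompleteSpace E] {F : Type*} [NormedAddCommGroup F]
    [NormedSpace ℂ F] {S : E →L[ℂ] F} (h : BoundedBelow S) : IsClosed (Set.range S) := by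
  obtain ⟨c, hc, hS⟩ := h
  have : AntilipschitzWith (⟨c⁻¹, by positivity⟩ : NNReal) S :=
    S.antilipschitz_of_bound fun x => by
      change ‖x‖ ≤ c⁻¹ * ‖S x‖
      rw [le_inv_mul_iff₀ hc]
      exact hS x
  exact this.isClosed_range S.uniformContinuous

/-- Operators bounded below form an open set. -/
theorem BoundedBelow.exists_sub_smul {F : Type*} [NormedAddCommGroup F] [NormedSpace ℂ F]
    {S : E →L[ℂ] F} (h : BoundedBelow S) (B : E →L[ℂ] F) :
    ∃ ε : ℝ, 0 < ε ∧ ∀ l : ℂ, ‖l‖ < ε → BoundedBelow (S - l • B) := by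
  obtain ⟨c, hc, hS⟩ := h
  refine ⟨c / (2 * (‖B‖ + 1)), by positivity, fun l hl => ⟨c / 2, by positivity, fun x => ?_⟩⟩
  have h1 : ‖l‖ * ‖B‖ ≤ c / 2 := by
    rw [lt_div_iff₀ (by positivity)] at hl
    nlinarith [norm_nonneg l]
  have h2 : ‖l • B x‖ ≤ c / 2 * ‖x‖ := by
    rw [norm_smul]
    calc ‖l‖ * ‖B x‖ ≤ ‖l‖ * (‖B‖ * ‖x‖) := by gcongr; exact B.le_opNorm x
      _ = ‖l‖ * ‖B‖ * ‖x‖ := by ring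
      _ ≤ _ := by gcongr
  have h3 := norm_sub_norm_le (S x) (l • B x)
  have h4 := hS x
  change c / 2 * ‖x‖ ≤ ‖S x - l • B x‖
  linarith

/-- Adjoining to `S` a map `J` whose image represents `m` independent classes modulo the range gives
an operator `F` that is injective with closed range, hence bounded below. This persists when `S`
becomes `S - l`, and injectivity then says that the same vectors stay independent modulo the new
range. -/
theorem eventually_le_deficiency [CompleteSpace E] {S : E →L[ℂ] E} (hS : BoundedBelow S)
    {m : ℕ} (hm : (m : ℕ∞) ≤ deficiency S) :
    ∀ᶠ l : ℂ in 𝓝 0, (m : ℕ∞) ≤ deficiency (S - l • (1 : E →L[ℂ] E)) := by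
  obtain ⟨v, hv⟩ := natCast_le_dim_iff.1 hm
  choose w hw using fun i => Submodule.mkQ_surjective _ (v i)
  let J : (Fin m → ℂ) →L[ℂ] E :=
    LinearMap.toContinuousLinearMap (Fintype.linearCombination ℂ w)
  have hJ : ∀ c, J c = ∑ i, c i • w i := fun c => by
    simp [J, Fintype.linearCombination_apply]
  let F : E × (Fin m → ℂ) →L[ℂ] E := S.coprod J
  have hinj : Function.Injective F := by
    refine (injective_iff_map_eq_zero F).2 ?_
    rintro ⟨x, c⟩ hx
    have hx : S x + ∑ i, c i • w i = 0 := by rw [← hJ]; exact hx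
    have hmk : ∑ i, c i • v i = 0 := by
      have h1 : ((rangeSpace S).mkQ (∑ i, c i • w i)) = 0 := by
        rw [Submodule.mkQ_apply, Submodule.Quotient.mk_eq_zero]
        exact ⟨-x, by
          change S (-x) = _
          rw [map_neg, neg_eq_iff_add_eq_zero]; exact hx⟩
      simpa [hw] using h1
    have hc : c = 0 := funext fun i => Fintype.linearIndependent_iff.1 hv c hmk i
    subst hc
    have hx0 : S x = 0 := by simpa using hx
    rw [hS.injective (hx0.trans (map_zero S).symm)]
    rfl
  have hclosed : IsClosed (Set.range F) := by
    have h1 : (Set.range F) = ((rangeSpace S ⊔ LinearMap.range (J : (Fin m → ℂ) →ₗ[ℂ] E) :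
        Submodule ℂ E) : Set E) := by
      have := LinearMap.range_coprod (S : E →ₗ[ℂ] E) (J : (Fin m → ℂ) →ₗ[ℂ] E)
      rw [rangeSpace, ← this]
      rfl
    rw [h1]
    exact Submodule.isClosed_sup_finiteDimensional _ _ hS.isClosed_range
  obtain ⟨ε, hε, hF⟩ := (boundedBelow_of_injective_of_isClosed_range hinj hclosed).exists_sub_smul
    (ContinuousLinearMap.fst ℂ E (Fin m → ℂ))
  filter_upwards [Metric.ball_mem_nhds (0 : ℂ) hε] with l hl
  have hFl := (hF l (by simpa using hl)).injective
  refine natCast_le_dim_iff.2 ⟨fun i => Submodule.mkQ _ (w i), ?_⟩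
  refine Fintype.linearIndependent_iff.2 fun c hc => ?_
  have hc' : (rangeSpace (S - l • (1 : E →L[ℂ] E))).mkQ (∑ i, c i • w i) = 0 := by
    simpa using hc
  rw [Submodule.mkQ_apply, Submodule.Quotient.mk_eq_zero] at hc'
  obtain ⟨x, hx⟩ := hc'
  have hx : (S - l • (1 : E →L[ℂ] E)) x = ∑ i, c i • w i := hx
  have hzero : (F - l • ContinuousLinearMap.fst ℂ E (Fin m → ℂ)) (-x, c) = 0 := by
    have : (F - l • ContinuousLinearMap.fst ℂ E (Fin m → ℂ)) (-x, c) =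
        -((S - l • (1 : E →L[ℂ] E)) x) + J c := by
      simp [F]; abel
    rw [this, hx, hJ, neg_add_cancel]
  have := hFl (hzero.trans (map_zero _).symm)
  exact fun i => congrFun (congrArg Prod.snd this) i

/-- Dual to `eventually_nullity_eq`: a left inverse `L` gives `S - l = (1 - l L) S`. -/
theorem eventually_deficiency_eq [CompleteSpace E] {S : E →L[ℂ] E} (hS : BoundedBelow S)
    (hfin : deficiency S ≠ ⊤) :
    ∀ᶠ l : ℂ in 𝓝 0, deficiency (S - l • (1 : E →L[ℂ] E)) = deficiency S := by
  have : FiniteDimensional ℂ (E ⧸ rangeSpace S) := finiteDimensional_of_dim_ne_top hfin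
  have hcl : IsClosed (rangeSpace S : Set E) := hS.isClosed_range
  have hcompl : (rangeSpace S).ClosedComplemented :=
    Submodule.ClosedComplemented.of_finiteDimensional_quotient hcl
  obtain ⟨L, hL⟩ :=
    ContinuousLinearMap.HasLeftInverse.of_injective_of_isClosed_range_of_closedComplement_range
      hS.injective hS.isClosed_range hcompl
  have hLS : L * S = 1 := by ext x; exact hL x
  filter_upwards [eventually_isUnit_one_sub_smul L] with l hl
  obtain ⟨U, hU⟩ := hl
  have hfac : S - l • (1 : E →L[ℂ] E) = U * S := by
    rw [hU, sub_mul, one_mul, smul_mul_assoc, hLS]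
  let e : E ≃ₗ[ℂ] E := (ContinuousLinearEquiv.unitsEquiv ℂ E U).toLinearEquiv
  have hrange : (rangeSpace S).map (e : E →ₗ[ℂ] E) = rangeSpace (S - l • (1 : E →L[ℂ] E)) := by
    rw [hfac]
    exact (LinearMap.range_comp (S : E →ₗ[ℂ] E) (e : E →ₗ[ℂ] E)).symm
  exact (dim_congr (Submodule.Quotient.equiv _ _ e hrange)).symm

/-- The deficiency of an operator bounded below is stable under small scalar perturbations. -/
theorem exists_deficiency_sub_smul_eq [CompleteSpace E] {S : E →L[ℂ] E} (hS : BoundedBelow S) :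
    ∃ ε : ℝ, 0 < ε ∧ ∀ l : ℂ, ‖l‖ < ε → BoundedBelow (S - l • (1 : E →L[ℂ] E)) ∧
      deficiency (S - l • (1 : E →L[ℂ] E)) = deficiency S := by
  obtain ⟨ε, hε, hs⟩ := hS.exists_sub_smul 1
  refine ⟨ε, hε, fun l hl => ⟨hs l hl, ?_⟩⟩
  have hconn : IsPreconnected (Metric.ball (0 : ℂ) ε) := (convex_ball 0 ε).isPreconnected
  have h := eq_of_isPreconnected hconn (f := fun l : ℂ => deficiency (S - l • (1 : E →L[ℂ] E)))
    (fun z hz m hm => eventually_nhds_of_eventually_zero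
      (P := fun S => (m : ℕ∞) ≤ deficiency S)
      (eventually_le_deficiency (hs z (by simpa using hz)) hm))
    (fun z hz hfin => eventually_nhds_of_eventually_zero
      (P := fun B => deficiency B = deficiency (S - z • (1 : E →L[ℂ] E)))
      (eventually_deficiency_eq (hs z (by simpa using hz)) hfin))
    (x := l) (y := 0) (by simpa using hl) (by simpa using hε)
  simpa using h

end Perturbation

end GzKato

namespace GzKato

/-! ### The quasi-nilpotent part through geometric bounds. -/

section QuasiNilpotentPart

variable {X : Type*} [NormedAddCommGroup X] [NormedSpace ℂ X]

/-- Trades `n`-th roots for geometric bounds, in which a constant factor can be absorbed by changing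
the rate. -/
theorem mem_quasiNilpotentPart_iff {T : X →L[ℂ] X} {x : X} :
    x ∈ quasiNilpotentPart T ↔ ∀ r : ℝ, 0 < r → ∀ᶠ n : ℕ in atTop, ‖(T ^ n) x‖ ≤ r ^ n := by
  change Tendsto (fun n : ℕ => ‖(T ^ n) x‖ ^ (1 / (n : ℝ))) atTop (𝓝 0) ↔ _
  simp only [one_div]
  constructor
  · intro h r hr
    filter_upwards [h.eventually (gt_mem_nhds hr), eventually_ne_atTop 0] with n hn hn0
    rw [← Real.rpow_inv_natCast_pow (norm_nonneg ((T ^ n) x)) hn0]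
    gcongr
  · intro h
    rw [Metric.tendsto_nhds]
    intro e he
    filter_upwards [h (e / 2) (by positivity), eventually_ne_atTop 0] with n hn hn0
    rw [Real.dist_eq, sub_zero, abs_of_nonneg (by positivity)]
    calc ‖(T ^ n) x‖ ^ (n : ℝ)⁻¹ ≤ ((e / 2) ^ n) ^ (n : ℝ)⁻¹ := by gcongr
      _ = e / 2 := Real.pow_rpow_inv_natCast (by positivity) hn0
      _ < e := by linarith

theorem eventually_mul_pow_le (C : ℝ) {r : ℝ} (hr : 0 < r) :
    ∀ᶠ n : ℕ in atTop, C * (r / 2) ^ n ≤ r ^ n := by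
  have ht : Tendsto (fun n : ℕ => C * (1 / 2 : ℝ) ^ n) atTop (𝓝 0) := by
    simpa using (tendsto_pow_atTop_nhds_zero_of_lt_one (by norm_num : (0 : ℝ) ≤ 1 / 2)
      (by norm_num)).const_mul C
  filter_upwards [ht.eventually (gt_mem_nhds one_pos)] with n hn
  calc C * (r / 2) ^ n = C * (1 / 2) ^ n * r ^ n := by rw [div_eq_mul_one_div, mul_pow]; ring
    _ ≤ 1 * r ^ n := by gcongr
    _ = r ^ n := one_mul _

/-- An operator intertwining `T` and `S` maps `H₀(T)` to `H₀(S)`. -/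
theorem map_mem_quasiNilpotentPart {Y : Type*} [NormedAddCommGroup Y] [NormedSpace ℂ Y]
    {T : X →L[ℂ] X} {S : Y →L[ℂ] Y} (f : X →L[ℂ] Y) (hf : ∀ x, f (T x) = S (f x)) {x : X}
    (hx : x ∈ quasiNilpotentPart T) : f x ∈ quasiNilpotentPart S := by
  rw [mem_quasiNilpotentPart_iff] at hx ⊢
  intro r hr
  have hpow : ∀ n : ℕ, (S ^ n) (f x) = f ((T ^ n) x) := by
    intro n
    induction n with
    | zero => simp
    | succ n ih => rw [pow_succ', pow_succ', mul_apply_eq_comp, ih, ← hf]; rfl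
  filter_upwards [hx (r / 2) (by positivity), eventually_mul_pow_le ‖f‖ hr] with n h1 h2
  rw [hpow]
  calc ‖f ((T ^ n) x)‖ ≤ ‖f‖ * ‖(T ^ n) x‖ := f.le_opNorm _
    _ ≤ ‖f‖ * (r / 2) ^ n := by gcongr
    _ ≤ r ^ n := h2

/-- The quasi-nilpotent part of an operator bounded below is trivial. -/
theorem BoundedBelow.quasiNilpotentPart_eq_bot {T : X →L[ℂ] X} (hT : BoundedBelow T) :
    quasiNilpotentPart T = ⊥ := by
  obtain ⟨c, hc, h⟩ := hT
  have hpow : ∀ (n : ℕ) (x : X), c ^ n * ‖x‖ ≤ ‖(T ^ n) x‖ := by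
    intro n x
    induction n with
    | zero => simp
    | succ n ih =>
      rw [pow_succ', pow_succ', mul_assoc]
      exact (mul_le_mul_of_nonneg_left ih hc.le).trans (h _)
  rw [eq_bot_iff]
  intro x hx
  rw [mem_quasiNilpotentPart_iff] at hx
  have ht := tendsto_pow_atTop_nhds_zero_of_lt_one (by norm_num : (0 : ℝ) ≤ 1 / 2) (by norm_num)
  refine norm_le_zero_iff.1 (ge_of_tendsto ht ?_)
  -- At half the lower bound, `c ^ n * ‖x‖ ≤ (c / 2) ^ n`, which leaves `‖x‖ ≤ (1 / 2) ^ n`.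
  filter_upwards [hx (c / 2) (by positivity)] with n hn
  have h1 := (hpow n x).trans hn
  rw [div_eq_mul_one_div, mul_pow] at h1
  exact le_of_mul_le_mul_left h1 (by positivity)

end QuasiNilpotentPart

/-! ### Semi-regular operators and their Kato splitting along the hyper-range. -/

section SemiRegular

variable {X : Type*} [NormedAddCommGroup X] [NormedSpace ℂ X] {S : X →L[ℂ] X}

theorem mem_rangeSpace_pow_succ {n : ℕ} {y : X} :
    y ∈ rangeSpace (S ^ (n + 1)) ↔ ∃ x ∈ rangeSpace (S ^ n), S x = y := by
  rw [pow_succ']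
  constructor
  · rintro ⟨z, rfl⟩
    exact ⟨(S ^ n) z, ⟨z, rfl⟩, rfl⟩
  · rintro ⟨_, ⟨z, rfl⟩, rfl⟩
    exact ⟨z, rfl⟩

/-- Two preimages of `S x` differ by a kernel vector, which lies in every `R(Sⁿ)`. All the structure
of the hyper-range comes from this cancellation. -/
theorem IsSemiRegular.apply_mem_rangeSpace_pow_succ_iff (hS : IsSemiRegular S) {n : ℕ} {x : X} :
    S x ∈ rangeSpace (S ^ (n + 1)) ↔ x ∈ rangeSpace (S ^ n) := by
  rw [mem_rangeSpace_pow_succ]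
  refine ⟨?_, fun hx => ⟨x, hx, rfl⟩⟩
  rintro ⟨y, hy, hyx⟩
  have hker : x - y ∈ nullSpace S := by
    change S (x - y) = 0
    rw [map_sub, hyx, sub_self]
  simpa using add_mem (hS.2 n hker) hy

theorem rangeSpace_pow_succ_le (n : ℕ) : rangeSpace (S ^ (n + 1)) ≤ rangeSpace (S ^ n) := by
  rintro _ ⟨z, rfl⟩
  exact ⟨S z, by rw [pow_succ]; rfl⟩

/-- By induction: `S` is a quotient map onto its complete range, and pulling `R(Sⁿ⁺¹)` back along it
gives `R(Sⁿ)`. -/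
theorem IsSemiRegular.isClosed_rangeSpace_pow [CompleteSpace X] (hS : IsSemiRegular S) (n : ℕ) :
    IsClosed (rangeSpace (S ^ n) : Set X) := by
  induction n with
  | zero =>
    have : rangeSpace (S ^ 0) = ⊤ := LinearMap.range_eq_top.2 fun x => ⟨x, rfl⟩
    rw [this]
    exact isClosed_univ
  | succ n ih =>
    have : CompleteSpace (rangeSpace S) := hS.1.completeSpace_coe
    let f : X →L[ℂ] rangeSpace S := S.codRestrict (rangeSpace S) fun x => ⟨x, rfl⟩
    have hf : Function.Surjective f := by
      rintro ⟨_, x, rfl⟩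
      exact ⟨x, rfl⟩
    have h1 : IsClosed {z : rangeSpace S | (z : X) ∈ rangeSpace (S ^ (n + 1))} := by
      rw [← (f.isQuotientMap hf).isClosed_preimage]
      convert ih using 1
      ext x
      exact hS.apply_mem_rangeSpace_pow_succ_iff
    have h2 := hS.1.isClosedEmbedding_subtypeVal.isClosedMap _ h1
    convert h2 using 1
    ext y
    refine ⟨fun hy => ?_, ?_⟩
    · obtain ⟨x, -, rfl⟩ := mem_rangeSpace_pow_succ.1 hy
      exact ⟨⟨S x, x, rfl⟩, hy, rfl⟩
    · rintro ⟨z, hz, rfl⟩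
      exact hz

/-- The hyper-range `⋂ₙ R(Sⁿ)`. -/
def hyperRange (S : X →L[ℂ] X) : Submodule ℂ X :=
  ⨅ n : ℕ, rangeSpace (S ^ n)

theorem mem_hyperRange {x : X} : x ∈ hyperRange S ↔ ∀ n : ℕ, x ∈ rangeSpace (S ^ n) :=
  Submodule.mem_iInf _

theorem IsSemiRegular.isClosed_hyperRange [CompleteSpace X] (hS : IsSemiRegular S) :
    IsClosed (hyperRange S : Set X) := by
  rw [hyperRange, Submodule.coe_iInf]
  exact isClosed_iInter hS.isClosed_rangeSpace_pow

theorem IsSemiRegular.apply_mem_hyperRange_iff (hS : IsSemiRegular S) {x : X} :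
    S x ∈ hyperRange S ↔ x ∈ hyperRange S := by
  simp only [mem_hyperRange]
  refine ⟨fun h n => hS.apply_mem_rangeSpace_pow_succ_iff.1 (h (n + 1)), fun h n => ?_⟩
  exact rangeSpace_pow_succ_le n (hS.apply_mem_rangeSpace_pow_succ_iff.2 (h n))

/-- Every preimage of a hyper-range vector already lies in the hyper-range, so no choice has to be
made compatibly over `n`. -/
theorem IsSemiRegular.exists_mem_hyperRange (hS : IsSemiRegular S) {y : X}
    (hy : y ∈ hyperRange S) : ∃ x ∈ hyperRange S, S x = y := by
  obtain ⟨x, -, rfl⟩ := mem_rangeSpace_pow_succ.1 (mem_hyperRange.1 hy 1)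
  exact ⟨x, hS.apply_mem_hyperRange_iff.1 hy, rfl⟩

/-- The closed subspace `K` is invariant under `S`, with `D` the restriction of `S` to `K` and `Q`
the operator induced on the quotient by `K`; moreover `D` is onto and `Q` is bounded below. -/
structure IsKatoSplitting (S : X →L[ℂ] X) (K : Submodule ℂ X) [IsClosed (K : Set X)]
    (D : K →L[ℂ] K) (Q : (X ⧸ K) →L[ℂ] (X ⧸ K)) : Prop where
  coe_apply : ∀ k : K, (D k : X) = S k
  mk_apply : ∀ x : X, Q (K.mkQL x) = K.mkQL (S x)
  surjective : Function.Surjective D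
  boundedBelow : BoundedBelow Q

/-- On the quotient, injectivity is the cancellation property, and the range is closed because its
preimage in `X` is the range of `S`, which contains the hyper-range. -/
theorem IsSemiRegular.exists_isKatoSplitting [CompleteSpace X] (hS : IsSemiRegular S)
    [IsClosed (hyperRange S : Set X)] :
    ∃ D Q, IsKatoSplitting S (hyperRange S) D Q := by
  set K := hyperRange S with hK
  have hinv : ∀ x ∈ K, S x ∈ K := fun x hx => hS.apply_mem_hyperRange_iff.2 hx
  let D : K →L[ℂ] K := S.restrict hinv
  let Q : (X ⧸ K) →L[ℂ] (X ⧸ K) := K.liftQL (K.mkQL.comp S) fun x hx =>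
    (Submodule.Quotient.mk_eq_zero K).2 (hinv x hx)
  have hQ : ∀ x : X, Q (K.mkQL x) = K.mkQL (S x) := fun x => rfl
  refine ⟨D, Q, fun k => rfl, hQ, ?_, ?_⟩
  · rintro ⟨y, hy⟩
    obtain ⟨x, hx, rfl⟩ := hS.exists_mem_hyperRange hy
    exact ⟨⟨x, hx⟩, rfl⟩
  · refine boundedBelow_of_injective_of_isClosed_range ?_ ?_
    · refine (injective_iff_map_eq_zero Q).2 fun q hq => ?_
      obtain ⟨x, rfl⟩ := K.mkQ_surjective q
      exact (Submodule.Quotient.mk_eq_zero K).2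
        (hS.apply_mem_hyperRange_iff.1 ((Submodule.Quotient.mk_eq_zero K).1 hq))
    · rw [← K.isQuotientMap_mkQL.isClosed_preimage]
      convert hS.1 using 1
      ext y
      constructor
      · rintro ⟨q, hq⟩
        obtain ⟨x, rfl⟩ := K.mkQ_surjective q
        have h1 : y - S x ∈ K := (Submodule.Quotient.eq K).1 hq.symm
        obtain ⟨z, -, hz⟩ := hS.exists_mem_hyperRange h1
        exact ⟨z + x, by
          change S (z + x) = y
          rw [map_add, hz, sub_add_cancel]⟩
      · rintro ⟨x, rfl⟩
        exact ⟨K.mkQL x, hQ x⟩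

namespace IsKatoSplitting

variable {K : Submodule ℂ X} [IsClosed (K : Set X)] {D : K →L[ℂ] K}
  {Q : (X ⧸ K) →L[ℂ] (X ⧸ K)}

theorem mem_of_apply_mem (h : IsKatoSplitting S K D Q) {x : X} (hx : S x ∈ K) : x ∈ K := by
  refine (Submodule.Quotient.mk_eq_zero K).1 (h.boundedBelow.injective ?_)
  rw [map_zero]
  exact (h.mk_apply x).trans ((Submodule.Quotient.mk_eq_zero K).2 hx)

theorem nullSpace_le (h : IsKatoSplitting S K D Q) : nullSpace S ≤ K := fun x hx => by
  have hx : S x = 0 := hx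
  exact h.mem_of_apply_mem (hx ▸ K.zero_mem)

theorem le_rangeSpace_pow (h : IsKatoSplitting S K D Q) (n : ℕ) : K ≤ rangeSpace (S ^ n) := by
  induction n with
  | zero => exact fun x _ => ⟨x, rfl⟩
  | succ n ih =>
    intro y hy
    obtain ⟨x, hx⟩ := h.surjective ⟨y, hy⟩
    refine mem_rangeSpace_pow_succ.2 ⟨x, ih x.2, ?_⟩
    rw [← h.coe_apply, hx]

theorem mem_rangeSpace_iff (h : IsKatoSplitting S K D Q) {y : X} :
    y ∈ rangeSpace S ↔ K.mkQL y ∈ rangeSpace Q := by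
  constructor
  · rintro ⟨x, rfl⟩
    exact ⟨K.mkQL x, h.mk_apply x⟩
  · rintro ⟨q, hq⟩
    obtain ⟨x, rfl⟩ := K.mkQ_surjective q
    have h1 : y - S x ∈ K := (Submodule.Quotient.eq K).1 (hq.symm.trans (h.mk_apply x))
    obtain ⟨z, hz⟩ := h.surjective ⟨_, h1⟩
    refine ⟨z + x, ?_⟩
    change S (z + x) = y
    rw [map_add, ← h.coe_apply, hz, sub_add_cancel]

/-- The converse direction, for any such `K`: it lets perturbation be carried out on `D` and `Q`
with `K` held fixed. -/
theorem isSemiRegular [CompleteSpace X] (h : IsKatoSplitting S K D Q) : IsSemiRegular S := by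
  refine ⟨?_, fun n => h.nullSpace_le.trans (h.le_rangeSpace_pow n)⟩
  have h1 : (rangeSpace S : Set X) = K.mkQL ⁻¹' Set.range Q := by
    ext y
    exact h.mem_rangeSpace_iff
  rw [h1]
  exact h.boundedBelow.isClosed_range.preimage K.mkQL.continuous

theorem le_analyticCore [CompleteSpace X] (h : IsKatoSplitting S K D Q) : K ≤ analyticCore S := by
  intro x hx
  have : CompleteSpace K := IsClosed.completeSpace_coe (s := (K : Set X))
  obtain ⟨C, hC, hu⟩ := exists_backward_orbit h.surjective
  obtain ⟨u, hu0, hu1, hu2⟩ := hu ⟨x, hx⟩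
  refine ⟨C, hC, fun n => u n, (congrArg Subtype.val hu0).symm, fun n => ?_, fun n => hu2 n⟩
  rw [← h.coe_apply, hu1]

/-- The image in the quotient lies in the quasi-nilpotent part of `Q`, which is trivial. -/
theorem quasiNilpotentPart_le (h : IsKatoSplitting S K D Q) : quasiNilpotentPart S ≤ K := by
  intro x hx
  have h1 := map_mem_quasiNilpotentPart K.mkQL (fun x => (h.mk_apply x).symm) hx
  rw [h.boundedBelow.quasiNilpotentPart_eq_bot] at h1
  exact (Submodule.Quotient.mk_eq_zero K).1 h1

theorem nullity_eq (h : IsKatoSplitting S K D Q) : nullity S = nullity D := by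
  have h1 : nullSpace D = (nullSpace S).comap K.subtype := by
    ext k
    change D k = 0 ↔ S k = 0
    rw [← h.coe_apply]
    exact Subtype.ext_iff
  rw [nullity, nullity, h1]
  exact (dim_congr (Submodule.comapSubtypeEquivOfLe h.nullSpace_le)).symm

theorem deficiency_eq (h : IsKatoSplitting S K D Q) : deficiency S = deficiency Q := by
  let f : X →ₗ[ℂ] (X ⧸ K) ⧸ rangeSpace Q := (rangeSpace Q).mkQ ∘ₗ K.mkQ
  have hf : Function.Surjective f := (Submodule.mkQ_surjective _).comp (Submodule.mkQ_surjective _)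
  have hker : rangeSpace S = LinearMap.ker f := by
    ext y
    rw [h.mem_rangeSpace_iff]
    exact (Submodule.Quotient.mk_eq_zero _).symm
  rw [deficiency, codim, hker]
  exact dim_congr (f.quotKerEquivOfSurjective hf)

theorem sub_smul (h : IsKatoSplitting S K D Q) {l : ℂ}
    (hD : Function.Surjective (D - l • (1 : K →L[ℂ] K)))
    (hQ : BoundedBelow (Q - l • (1 : (X ⧸ K) →L[ℂ] (X ⧸ K)))) :
    IsKatoSplitting (S - l • (1 : X →L[ℂ] X)) K (D - l • (1 : K →L[ℂ] K))
      (Q - l • (1 : (X ⧸ K) →L[ℂ] (X ⧸ K))) where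
  coe_apply k := by simp [h.coe_apply]
  mk_apply x := by
    change Q (K.mkQL x) - l • K.mkQL x = K.mkQL (S x - l • x)
    rw [map_sub, map_smul, h.mk_apply]
  surjective := hD
  boundedBelow := hQ

end IsKatoSplitting

/-- Small scalar perturbations of a semi-regular operator are semi-regular, with the same nullity
and deficiency. -/
theorem IsSemiRegular.exists_sub_smul [CompleteSpace X] (hS : IsSemiRegular S) :
    ∃ ε : ℝ, 0 < ε ∧ ∀ l : ℂ, ‖l‖ < ε →
      IsSemiRegular (S - l • (1 : X →L[ℂ] X)) ∧
      nullity (S - l • (1 : X →L[ℂ] X)) = nullity S ∧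
      deficiency (S - l • (1 : X →L[ℂ] X)) = deficiency S ∧
      nullSpace (S - l • (1 : X →L[ℂ] X)) ≤ analyticCore (S - l • (1 : X →L[ℂ] X)) ∧
      quasiNilpotentPart (S - l • (1 : X →L[ℂ] X)) ≤ rangeSpace (S - l • (1 : X →L[ℂ] X)) := by
  have hcl : IsClosed (hyperRange S : Set X) := hS.isClosed_hyperRange
  have : CompleteSpace (hyperRange S) := hcl.completeSpace_coe
  obtain ⟨D, Q, h⟩ := hS.exists_isKatoSplitting
  obtain ⟨a, ha, hD⟩ := exists_nullity_sub_smul_eq h.surjective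
  obtain ⟨b, hb, hQ⟩ := exists_deficiency_sub_smul_eq h.boundedBelow
  refine ⟨min a b, lt_min ha hb, fun l hl => ?_⟩
  obtain ⟨hD1, hD2⟩ := hD l (hl.trans_le (min_le_left _ _))
  obtain ⟨hQ1, hQ2⟩ := hQ l (hl.trans_le (min_le_right _ _))
  have h' := h.sub_smul hD1 hQ1
  refine ⟨h'.isSemiRegular, ?_, ?_, h'.nullSpace_le.trans h'.le_analyticCore, ?_⟩
  · rw [h'.nullity_eq, hD2, h.nullity_eq]
  · rw [h'.deficiency_eq, hQ2, h.deficiency_eq]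
  · simpa using h'.quasiNilpotentPart_le.trans (h'.le_rangeSpace_pow 1)

end SemiRegular

end GzKato

namespace GzKato

/-! ### Restrictions and a criterion for quasi-nilpotence. -/

section Restriction

variable {X : Type*} [NormedAddCommGroup X] [NormedSpace ℂ X]

theorem sub_smul_apply_coe (T : X →L[ℂ] X) (M : Submodule ℂ X) (hM : ∀ x ∈ M, T x ∈ M) (μ : ℂ)
    (x : M) : (T - μ • (1 : X →L[ℂ] X)) x =
      (((restr T M hM - μ • (1 : M →L[ℂ] M)) x : M) : X) := by
  rfl

theorem coe_restr_pow (S : X →L[ℂ] X) (M : Submodule ℂ X) (hM : ∀ x ∈ M, S x ∈ M) (n : ℕ)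
    (x : M) : ((restr S M hM ^ n) x : X) = (S ^ n) x := by
  induction n with
  | zero => rfl
  | succ n ih =>
    rw [pow_succ', pow_succ', mul_apply_eq_comp, mul_apply_eq_comp, ← ih]
    rfl

/-- An operator whose powers decay faster than every geometric sequence is quasi-nilpotent. -/
theorem isQuasiNilpotent_of_decay [CompleteSpace X] {G : X →L[ℂ] X}
    (h : ∀ r : ℝ, 0 < r → ∃ C : ℝ, ∀ n : ℕ, ‖G ^ n‖ ≤ C * r ^ n) : IsQuasiNilpotent G := by
  intro ν hν
  have hν0 : 0 < ‖ν‖ := norm_pos_iff.2 hν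
  by_contra hu
  have hmem : ν ∈ spectrum ℂ G := by
    rw [spectrum.mem_iff, Algebra.algebraMap_eq_smul_one, ← neg_sub, IsUnit.neg_iff]
    exact hu
  -- A spectral value satisfies `‖ν‖ ^ n ≤ ‖G ^ n‖ * ‖1‖`. Absorbing the constants doubles the rate
  -- to `‖ν‖ / 2`, still strictly below `‖ν‖`.
  obtain ⟨C, hC⟩ := h (‖ν‖ / 4) (by positivity)
  have hle : ∀ n : ℕ, ‖ν‖ ^ n ≤ C * ‖(1 : X →L[ℂ] X)‖ * (‖ν‖ / 4) ^ n := by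
    intro n
    have h1 := spectrum.norm_le_norm_mul_of_mem (spectrum.pow_mem_pow G n hmem)
    rw [norm_pow] at h1
    calc ‖ν‖ ^ n ≤ ‖G ^ n‖ * ‖(1 : X →L[ℂ] X)‖ := h1
      _ ≤ C * (‖ν‖ / 4) ^ n * ‖(1 : X →L[ℂ] X)‖ := by gcongr; exact hC n
      _ = _ := by ring
  obtain ⟨n, h1, h2⟩ := ((eventually_mul_pow_le (C * ‖(1 : X →L[ℂ] X)‖)
    (half_pos hν0)).and (eventually_ne_atTop 0)).exists
  have h3 := hle n
  rw [show ‖ν‖ / 4 = ‖ν‖ / 2 / 2 by ring] at h3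
  have h4 : (‖ν‖ / 2) ^ n < ‖ν‖ ^ n := pow_lt_pow_left₀ (half_lt_self hν0) (by positivity) h2
  linarith

end Restriction

/-! ### Gluing the semi-regular, invertible and quasi-nilpotent pieces. -/

section Splitting

variable {X : Type*} [NormedAddCommGroup X] [NormedSpace ℂ X]

/-- The operator `S` is the direct sum of `A` on `M` and `B` on `N`, and `B` is in turn the direct
sum of an invertible and a quasi-nilpotent operator, with respect to the idempotent `p`. -/
structure IsSpectralSplitting (S : X →L[ℂ] X) {M N : Submodule ℂ X} (A : M →L[ℂ] M)
    (B : N →L[ℂ] N) (πM : X →L[ℂ] M) (πN : X →L[ℂ] N) (p c : N →L[ℂ] N) : Prop where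
  add_eq : ∀ x, (πM x : X) + πN x = x
  left_left : ∀ m : M, πM m = m
  left_right : ∀ n : N, πM n = 0
  right_left : ∀ m : M, πN m = 0
  right_right : ∀ n : N, πN n = n
  coe_left : ∀ m : M, S m = A m
  coe_right : ∀ n : N, S n = B n
  idem : p * p = p
  comm : B * p = p * B
  mul_inv : B * c = 1 - p
  inv_mul : c * B = 1 - p
  decay : ∀ r : ℝ, 0 < r → ∃ C : ℝ, ∀ n : ℕ, ‖B ^ n * p‖ ≤ C * r ^ n

namespace IsSpectralSplitting

variable {S : X →L[ℂ] X} {M N : Submodule ℂ X} {A : M →L[ℂ] M}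
    {B : N →L[ℂ] N} {πM : X →L[ℂ] M} {πN : X →L[ℂ] N} {p c : N →L[ℂ] N}

theorem left_apply (h : IsSpectralSplitting S A B πM πN p c) (x : X) : πM (S x) = A (πM x) := by
  conv_lhs => rw [← h.add_eq x]
  rw [map_add, map_add, h.coe_left, h.coe_right, h.left_left, h.left_right, add_zero]

theorem right_apply (h : IsSpectralSplitting S A B πM πN p c) (x : X) : πN (S x) = B (πN x) := by
  conv_lhs => rw [← h.add_eq x]
  rw [map_add, map_add, h.coe_left, h.coe_right, h.right_left, h.right_right, zero_add]

theorem right_pow_apply (h : IsSpectralSplitting S A B πM πN p c) (n : ℕ) (x : X) :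
    πN ((S ^ n) x) = (B ^ n) (πN x) := by
  induction n with
  | zero => rfl
  | succ n ih =>
    rw [pow_succ', pow_succ', mul_apply_eq_comp, h.right_apply, ih]; rfl

theorem coe_left_pow (h : IsSpectralSplitting S A B πM πN p c) (n : ℕ) (m : M) :
    (S ^ n) m = ((A ^ n) m : M) := by
  induction n with
  | zero => rfl
  | succ n ih =>
    rw [pow_succ', pow_succ', mul_apply_eq_comp, ih, h.coe_left]; rfl

theorem coe_right_pow (h : IsSpectralSplitting S A B πM πN p c) (n : ℕ) (m : N) :
    (S ^ n) m = ((B ^ n) m : N) := by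
  induction n with
  | zero => rfl
  | succ n ih =>
    rw [pow_succ', pow_succ', mul_apply_eq_comp, ih, h.coe_right]; rfl

theorem idem_apply (h : IsSpectralSplitting S A B πM πN p c) (y : N) : p (p y) = p y :=
  DFunLike.congr_fun h.idem y

theorem comm_apply (h : IsSpectralSplitting S A B πM πN p c) (y : N) : B (p y) = p (B y) :=
  DFunLike.congr_fun h.comm y

theorem mul_inv_apply (h : IsSpectralSplitting S A B πM πN p c) (y : N) : B (c y) = y - p y :=
  DFunLike.congr_fun h.mul_inv y

theorem inv_mul_apply (h : IsSpectralSplitting S A B πM πN p c) (y : N) : c (B y) = y - p y :=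
  DFunLike.congr_fun h.inv_mul y

/-- The projection of `X` onto the quasi-nilpotent summand. -/
def projection (πN : X →L[ℂ] N) (p : N →L[ℂ] N) : X →L[ℂ] X :=
  N.subtypeL.comp (p.comp πN)

theorem projection_apply (x : X) : projection πN p x = (p (πN x) : X) := rfl

theorem projection_idem (h : IsSpectralSplitting S A B πM πN p c) (x : X) :
    projection πN p (projection πN p x) = projection πN p x := by
  simp only [projection_apply, h.right_right, h.idem_apply]

theorem projection_comm (h : IsSpectralSplitting S A B πM πN p c) (x : X) :
    projection πN p (S x) = S (projection πN p x) := by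
  simp only [projection_apply, h.right_apply, h.coe_right, h.comm_apply]

theorem mem_ker_projection {x : X} :
    x ∈ LinearMap.ker (projection πN p : X →ₗ[ℂ] X) ↔ p (πN x) = 0 := by
  rw [LinearMap.mem_ker]
  exact Submodule.coe_eq_zero

theorem mem_range_projection (h : IsSpectralSplitting S A B πM πN p c) {x : X} :
    x ∈ LinearMap.range (projection πN p : X →ₗ[ℂ] X) ↔ projection πN p x = x := by
  refine ⟨?_, fun hx => ⟨x, hx⟩⟩
  rintro ⟨y, rfl⟩
  exact h.projection_idem y

theorem isRed (h : IsSpectralSplitting S A B πM πN p c) :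
    IsRed S (LinearMap.ker (projection πN p : X →ₗ[ℂ] X))
      (LinearMap.range (projection πN p : X →ₗ[ℂ] X)) where
  isClosed_left := (projection πN p).isClosed_ker
  isClosed_right := by
    have h1 : ((LinearMap.range (projection πN p : X →ₗ[ℂ] X) : Submodule ℂ X) : Set X) =
        {x | projection πN p x = x} := by
      ext x
      exact h.mem_range_projection
    rw [h1]
    exact isClosed_eq (projection πN p).continuous continuous_id
  invariant_left x hx := by
    have hx : projection πN p x = 0 := hx
    change projection πN p (S x) = 0
    rw [h.projection_comm, hx, map_zero]
  invariant_right x hx := by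
    rw [h.mem_range_projection] at hx ⊢
    rw [h.projection_comm, hx]
  isCompl := by
    rw [isCompl_iff, disjoint_iff, codisjoint_iff, eq_bot_iff, eq_top_iff]
    constructor
    · rintro x ⟨hx1, hx2⟩
      have hx1 : projection πN p x = 0 := hx1
      have hx2 : projection πN p x = x := h.mem_range_projection.1 hx2
      exact hx2.symm.trans hx1
    · intro x _
      refine Submodule.mem_sup.2 ⟨x - projection πN p x, ?_, projection πN p x, ⟨x, rfl⟩,
        sub_add_cancel _ _⟩
      change projection πN p (x - projection πN p x) = 0
      rw [map_sub, h.projection_idem, sub_self]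

/-- A kernel vector has no component in the invertible part, since `c * B = 1 - p` annihilates its
`N`-component. -/
theorem right_eq_of_apply_eq_zero (h : IsSpectralSplitting S A B πM πN p c) {x : X}
    (hx : S x = 0) : πN x = p (πN x) := by
  have h1 := h.inv_mul_apply (πN x)
  rw [← h.right_apply, hx, map_zero, map_zero] at h1
  exact sub_eq_zero.1 h1.symm

/-- The kernel of the projection is `M` plus the invertible part of `N`. There the range is the
preimage of that of `A` under `πM`, and the kernel is that of `A`. -/
theorem isSemiRegular (h : IsSpectralSplitting S A B πM πN p c) (hA : IsSemiRegular A) :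
    IsSemiRegular (restr S _ h.isRed.invariant_left) := by
  set Y := LinearMap.ker (projection πN p : X →ₗ[ℂ] X)
  have hMY : ∀ m : M, (m : X) ∈ Y := fun m => by
    rw [mem_ker_projection, h.right_left, map_zero]
  constructor
  · have h1 : (rangeSpace (restr S Y h.isRed.invariant_left) : Set Y) =
        (fun y : Y => πM (y : X)) ⁻¹' (rangeSpace A : Set M) := by
      ext y
      constructor
      · rintro ⟨z, rfl⟩
        exact ⟨πM z, (h.left_apply z).symm⟩
      · rintro ⟨m, hm⟩
        have hm : A m = πM y := hm
        have hy : p (πN (y : X)) = 0 := mem_ker_projection.1 y.2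
        -- The structure does not say that `c` takes values in the kernel of `p`, so its value is
        -- cut down by `1 - p`; `B` still maps the result to `πN y`, because `p (πN y) = 0`.
        have hz : (((c (πN (y : X)) - p (c (πN (y : X))) : N)) : X) ∈ Y := by
          rw [mem_ker_projection, h.right_right, map_sub, h.idem_apply, sub_self]
        refine ⟨⟨_, Y.add_mem (hMY m) hz⟩, Subtype.ext ?_⟩
        change S ((m : X) + _) = (y : X)
        rw [map_add, h.coe_left, h.coe_right, hm, map_sub, h.comm_apply, h.mul_inv_apply, hy,
          sub_zero, hy, sub_zero, h.add_eq]
    rw [h1]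
    exact hA.1.preimage (πM.continuous.comp continuous_subtype_val)
  · intro n y hy
    have hy0 : S (y : X) = 0 := congrArg Subtype.val (show restr S Y _ y = 0 from hy)
    have hN : πN (y : X) = 0 := by
      rw [h.right_eq_of_apply_eq_zero hy0]
      exact mem_ker_projection.1 y.2
    have hyM : (πM (y : X) : X) = y := by
      have := h.add_eq (y : X)
      rwa [hN, Submodule.coe_zero, add_zero] at this
    have hker : πM (y : X) ∈ nullSpace A := by
      change A (πM (y : X)) = 0
      rw [← h.left_apply, hy0, map_zero]
    obtain ⟨m, hm⟩ := hA.2 n hker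
    have hm : (A ^ n) m = πM (y : X) := hm
    refine ⟨⟨m, hMY m⟩, Subtype.ext ?_⟩
    refine (coe_restr_pow S Y _ n ⟨m, hMY m⟩).trans ?_
    rw [h.coe_left_pow, hm, hyM]

theorem isQuasiNilpotent [CompleteSpace X] (h : IsSpectralSplitting S A B πM πN p c) :
    IsQuasiNilpotent (restr S _ h.isRed.invariant_right) := by
  set Y := LinearMap.range (projection πN p : X →ₗ[ℂ] X)
  have hcl : IsClosed (Y : Set X) := h.isRed.isClosed_right
  have : CompleteSpace Y := hcl.completeSpace_coe
  refine isQuasiNilpotent_of_decay fun r hr => ?_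
  obtain ⟨C, hC⟩ := h.decay r hr
  have hC0 : 0 ≤ C := by
    have h0 := (norm_nonneg (B ^ 0 * p)).trans (hC 0)
    rwa [pow_zero, mul_one] at h0
  refine ⟨C * ‖πN‖, fun n => ?_⟩
  refine ContinuousLinearMap.opNorm_le_bound _ (by positivity) fun y => ?_
  have hy : ((p (πN (y : X)) : N) : X) = y := h.mem_range_projection.1 y.2
  have h1 : ((restr S Y h.isRed.invariant_right ^ n) y : X) = ((B ^ n * p) (πN (y : X)) : N) := by
    rw [coe_restr_pow]
    conv_lhs => rw [← hy]
    rw [h.coe_right_pow]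
    rfl
  calc ‖(restr S Y h.isRed.invariant_right ^ n) y‖ = ‖(B ^ n * p) (πN (y : X))‖ :=
        congrArg norm h1
    _ ≤ ‖B ^ n * p‖ * (‖πN‖ * ‖(y : X)‖) :=
        ((B ^ n * p).le_opNorm _).trans (by gcongr; exact πN.le_opNorm _)
    _ ≤ C * r ^ n * (‖πN‖ * ‖(y : X)‖) := by gcongr; exact hC n
    _ = C * ‖πN‖ * r ^ n * ‖y‖ := by rw [Submodule.coe_norm]; ring

theorem isPseudoFredholm [CompleteSpace X] (h : IsSpectralSplitting S A B πM πN p c)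
    (hA : IsSemiRegular A) : IsPseudoFredholm S :=
  ⟨_, _, h.isRed, h.isSemiRegular hA, h.isQuasiNilpotent⟩

/-- A backward orbit `u` of `x` grows at most geometrically, while `p (πN x) = Bⁿ p (πN (u n))` and
`Bⁿ p` decays faster than any geometric sequence. -/
theorem right_eq_zero_of_mem_analyticCore (h : IsSpectralSplitting S A B πM πN p c) {x : X}
    (hx : x ∈ analyticCore S) : p (πN x) = 0 := by
  obtain ⟨e, he, u, hxu, hu, hue⟩ := hx
  have hpow : ∀ n, (S ^ n) (u n) = x := by
    intro n
    induction n with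
    | zero => exact hxu.symm
    | succ n ih => rw [pow_succ, mul_apply_eq_comp, hu, ih]
  obtain ⟨C, hC⟩ := h.decay (1 / (2 * e)) (by positivity)
  have hC0 : 0 ≤ C := by
    have h0 := (norm_nonneg (B ^ 0 * p)).trans (hC 0)
    rwa [pow_zero, mul_one] at h0
  have hbound : ∀ n : ℕ, ‖p (πN x)‖ ≤ C * ‖πN‖ * ‖x‖ * (1 / 2) ^ n := by
    intro n
    have h1 : p (πN x) = (B ^ n * p) (πN (u n)) := by
      have hcomm : B ^ n * p = p * B ^ n := (show Commute B p from h.comm).pow_left n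
      rw [hcomm, mul_apply_eq_comp, ← h.right_pow_apply, hpow]
    rw [h1]
    calc ‖(B ^ n * p) (πN (u n))‖ ≤ ‖B ^ n * p‖ * (‖πN‖ * ‖u n‖) :=
          ((B ^ n * p).le_opNorm _).trans (by gcongr; exact πN.le_opNorm _)
      _ ≤ C * (1 / (2 * e)) ^ n * (‖πN‖ * (e ^ n * ‖x‖)) := by
          gcongr
          · exact hC n
          · exact hue n
      _ = C * ‖πN‖ * ‖x‖ * ((1 / (2 * e)) ^ n * e ^ n) := by ring
      _ = _ := by
          rw [← mul_pow]
          congr 2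
          field_simp
  have ht : Tendsto (fun n : ℕ => C * ‖πN‖ * ‖x‖ * (1 / 2 : ℝ) ^ n) atTop (𝓝 0) := by
    simpa using (tendsto_pow_atTop_nhds_zero_of_lt_one (by norm_num : (0 : ℝ) ≤ 1 / 2)
      (by norm_num)).const_mul (C * ‖πN‖ * ‖x‖)
  exact norm_le_zero_iff.1 (ge_of_tendsto' ht hbound)

theorem nullSpace_inf_analyticCore (h : IsSpectralSplitting S A B πM πN p c)
    (hA : nullSpace A ≤ analyticCore A) :
    nullSpace S ⊓ analyticCore S = (nullSpace A).map M.subtype := by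
  ext x
  constructor
  · rintro ⟨hx1, hx2⟩
    have hx1 : S x = 0 := hx1
    have hN : πN x = 0 :=
      (h.right_eq_of_apply_eq_zero hx1).trans (h.right_eq_zero_of_mem_analyticCore hx2)
    refine ⟨πM x, ?_, ?_⟩
    · change A (πM x) = 0
      rw [← h.left_apply, hx1, map_zero]
    · have := h.add_eq x
      rwa [hN, Submodule.coe_zero, add_zero] at this
  · rintro ⟨m, hm, rfl⟩
    have hm0 : A m = 0 := hm
    refine ⟨?_, ?_⟩
    · change S (m : X) = 0
      rw [h.coe_left, hm0, Submodule.coe_zero]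
    · obtain ⟨e, he, u, hmu, hu, hue⟩ := hA hm
      exact ⟨e, he, fun n => u n, congrArg Subtype.val hmu,
        fun n => by rw [h.coe_left, hu], fun n => hue n⟩

theorem nullity_eq (h : IsSpectralSplitting S A B πM πN p c)
    (hA : nullSpace A ≤ analyticCore A) :
    nullity A = dim ↥(nullSpace S ⊓ analyticCore S) := by
  rw [h.nullSpace_inf_analyticCore hA]
  exact dim_congr (Submodule.equivMapOfInjective _ M.subtype_injective _)

theorem mem_rangeSpace_sup_quasiNilpotentPart (h : IsSpectralSplitting S A B πM πN p c)
    (hA : quasiNilpotentPart A ≤ rangeSpace A) {x : X} :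
    x ∈ rangeSpace S ⊔ quasiNilpotentPart S ↔ πM x ∈ rangeSpace A := by
  constructor
  · intro hx
    obtain ⟨_, ⟨y, rfl⟩, z, hz, rfl⟩ := Submodule.mem_sup.1 hx
    rw [map_add]
    exact add_mem ⟨πM y, (h.left_apply y).symm⟩
      (hA (map_mem_quasiNilpotentPart πM h.left_apply hz))
  · rintro ⟨m, hm⟩
    have hm : A m = πM x := hm
    -- From `B * c = 1 - p`, the `N`-component of `x` is `B (c (πN x)) + p (πN x)`, and the second
    -- term is in the quasi-nilpotent part by `decay`.
    refine Submodule.mem_sup.2 ⟨S (m + c (πN x)), ⟨_, rfl⟩, p (πN x), ?_, ?_⟩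
    · rw [mem_quasiNilpotentPart_iff]
      intro r hr
      obtain ⟨C, hC⟩ := h.decay (r / 2) (by positivity)
      filter_upwards [eventually_mul_pow_le (C * ‖πN x‖) hr] with n hn
      rw [h.coe_right_pow]
      calc ‖(B ^ n * p) (πN x)‖ ≤ ‖B ^ n * p‖ * ‖πN x‖ := (B ^ n * p).le_opNorm _
        _ ≤ C * (r / 2) ^ n * ‖πN x‖ := by gcongr; exact hC n
        _ = C * ‖πN x‖ * (r / 2) ^ n := by ring
        _ ≤ r ^ n := hn
    · rw [map_add, h.coe_left, h.coe_right, h.mul_inv_apply, hm, add_assoc, ← Submodule.coe_add,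
        sub_add_cancel, h.add_eq]

theorem deficiency_eq (h : IsSpectralSplitting S A B πM πN p c)
    (hA : quasiNilpotentPart A ≤ rangeSpace A) :
    deficiency A = codim (rangeSpace S ⊔ quasiNilpotentPart S) := by
  let f : X →ₗ[ℂ] M ⧸ rangeSpace A := (rangeSpace A).mkQ ∘ₗ (πM : X →ₗ[ℂ] M)
  have hf : Function.Surjective f :=
    (Submodule.mkQ_surjective _).comp fun m => ⟨m, h.left_left m⟩
  have hker : rangeSpace S ⊔ quasiNilpotentPart S = LinearMap.ker f := by
    ext x
    rw [h.mem_rangeSpace_sup_quasiNilpotentPart hA]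
    exact (Submodule.Quotient.mk_eq_zero _).symm
  rw [codim, hker]
  exact (dim_congr (f.quotKerEquivOfSurjective hf)).symm

end IsSpectralSplitting

/-- The Riesz projection for operators on a Banach space. -/
theorem exists_riesz_projection_operator [CompleteSpace X] {B : X →L[ℂ] X} {μ : ℂ}
    (h : ¬ AccPt μ (𝓟 (spectrum ℂ B))) :
    ∃ p c : X →L[ℂ] X, p * p = p ∧
      (B - μ • (1 : X →L[ℂ] X)) * p = p * (B - μ • (1 : X →L[ℂ] X)) ∧
      (B - μ • (1 : X →L[ℂ] X)) * c = 1 - p ∧ c * (B - μ • (1 : X →L[ℂ] X)) = 1 - p ∧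
      ∀ r : ℝ, 0 < r → ∃ C : ℝ, ∀ n : ℕ,
        ‖(B - μ • (1 : X →L[ℂ] X)) ^ n * p‖ ≤ C * r ^ n :=
  exists_riesz_projection h

/-- Zeroloidness enters only here, and only through `μ ≠ 0`; no smallness of `μ` is involved. -/
theorem IsGzKD.exists_isSpectralSplitting [CompleteSpace X] {T : X →L[ℂ] X}
    {M N : Submodule ℂ X} (h : IsGzKD T M N) {μ : ℂ} (hμ : μ ≠ 0) :
    ∃ B πM πN p c, IsSpectralSplitting (T - μ • (1 : X →L[ℂ] X))
      (restr T M h.invariant_left - μ • (1 : M →L[ℂ] M)) (N := N) B πM πN p c := by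
  have : CompleteSpace N := h.isClosed_right.completeSpace_coe
  have hacc : ¬ AccPt μ (𝓟 (spectrum ℂ (restr T N h.invariant_right))) :=
    fun hμ' => hμ (h.zeroloid hμ')
  obtain ⟨p, c, h1, h2, h3, h4, h5⟩ := exists_riesz_projection_operator hacc
  have htop : Submodule.IsTopCompl M N :=
    Submodule.IsCompl.isTopCompl_of_isClosed h.isCompl h.isClosed_left h.isClosed_right
  refine ⟨restr T N h.invariant_right - μ • (1 : N →L[ℂ] N), M.projectionOntoL N htop,
    N.projectionOntoL M htop.symm, p, c,
    { add_eq := fun x => ?_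
      left_left := M.projectionOntoL_apply_left htop
      left_right := M.projectionOntoL_apply_right htop
      right_left := N.projectionOntoL_apply_right htop.symm
      right_right := N.projectionOntoL_apply_left htop.symm
      coe_left := sub_smul_apply_coe T M h.invariant_left μ
      coe_right := sub_smul_apply_coe T N h.invariant_right μ
      idem := h1
      comm := h2
      mul_inv := h3
      inv_mul := h4
      decay := h5 }⟩
  simpa using DFunLike.congr_fun (Submodule.projectionL_add_projectionL_eq_id htop) x

end Splitting

end GzKato

/-! ### The punctured neighbourhood theorem. -/

theorem theorem2p6 {X : Type*} [NormedAddCommGroup X] [NormedSpace ℂ X] [CompleteSpace X]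
    (T : X →L[ℂ] X) (M N : Submodule ℂ X) (h : GzKato.IsGzKD T M N) :
    ∃ ε : ℝ, 0 < ε ∧ ∀ μ : ℂ, μ ∈ Metric.ball (0 : ℂ) ε \ {0} →
      GzKato.IsPseudoFredholm (T - μ • (1 : X →L[ℂ] X)) ∧
      (GzKato.nullity (GzKato.restr T M h.invariant_left) =
          GzKato.dim ↥(GzKato.nullSpace (T - μ • (1 : X →L[ℂ] X)) ⊓
            GzKato.analyticCore (T - μ • (1 : X →L[ℂ] X))) ∧
        GzKato.dim ↥(GzKato.nullSpace (T - μ • (1 : X →L[ℂ] X)) ⊓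
            GzKato.analyticCore (T - μ • (1 : X →L[ℂ] X))) ≤
          GzKato.nullity (T - μ • (1 : X →L[ℂ] X))) ∧
      (GzKato.deficiency (GzKato.restr T M h.invariant_left) =
          GzKato.codim (GzKato.rangeSpace (T - μ • (1 : X →L[ℂ] X)) ⊔
            GzKato.quasiNilpotentPart (T - μ • (1 : X →L[ℂ] X))) ∧
        GzKato.codim (GzKato.rangeSpace (T - μ • (1 : X →L[ℂ] X)) ⊔
            GzKato.quasiNilpotentPart (T - μ • (1 : X →L[ℂ] X))) ≤
          GzKato.deficiency (T - μ • (1 : X →L[ℂ] X))) := by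
  have : CompleteSpace M := h.isClosed_left.completeSpace_coe
  -- The radius depends on `T_M` alone; spectral points of `T_N` inside the disc are handled by
  -- their Riesz projections.
  obtain ⟨ε, hε, hA⟩ := h.semiRegular.exists_sub_smul
  refine ⟨ε, hε, fun μ hμ => ?_⟩
  obtain ⟨B, πM, πN, p, c, hs⟩ := h.exists_isSpectralSplitting (μ := μ) hμ.2
  obtain ⟨hsr, hnull, hdef, hcore, hqn⟩ := hA μ (by simpa using hμ.1)
  exact ⟨hs.isPseudoFredholm hsr,
    ⟨hnull.symm.trans (hs.nullity_eq hcore), GzKato.dim_le_of_le inf_le_left⟩,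
    ⟨hdef.symm.trans (hs.deficiency_eq hqn), GzKato.codim_le_of_le le_sup_left⟩⟩
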